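/- Let $n,p\ge 0$ be integers, not both zero, and let $M=S^{2n+1}\times S^{2p+1}=U(n+1)/U(n)\times U(p+1)/U(p)$ be the set of $(z,w)\in\mathbb C^{n+1}\times\mathbb C^{p+1}$ with $|z|=|w|=1$. Let $X^1=(iz,0)$, $X^2=(0,iw)$ be the invariant vector fields tangent to the circle factors of the fibration $M\to\mathbb{CP}^n\times\mathbb{CP}^p$, and let $H_{(z,w)}=z^{\perp}\times w^{\perp}$ (complex orthogonal complements), so that $TM=\mathbb RX^1\oplus\mathbb RX^2\oplus H$. For real $a$ and $c>0$ let $I(a,c)$ be the $U(n+1)\times U(p+1)$-invariant almost complex structure $$I(a,c)X^1=\tfrac ac X^1+\tfrac1c X^2,\qquad I(a,c)X^2=-\tfrac{a^2+c^2}{c}X^1-\tfrac ac X^2,\qquad I(a,c)h=ih\quad(h\in H),$$ and let $g(a,c)$ be the $U(n+1)\times U(p+1)$-invariant Riemannian metric for which $H$ is orthogonal to $X^1,X^2$, which on $H$ is the standard real inner product $\operatorname{Re}\langle\cdot,\cdot\rangle$, and $$g(X^1,X^1)=\tfrac1c,\qquad g(X^1,X^2)=-\tfrac ac,\qquad g(X^2,X^2)=\tfrac{a^2+c^2}{c};$$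 equivalently, $g(a,c)(X,Y)=\omega(X,I(a,c)Y)$, where $\omega$ is the invariant 2-form with $\omega(X^1,X^2)=1$, $\omega(X^j,H)=0$ and $\omega(h,h')=\operatorname{Re}\langle ih,h'\rangle$ on $H$. The Ricci tensor $\mathrm{Ric}$ of $g(a,c)$ is called $I(a,c)$-Hermitian if $\mathrm{Ric}(I(a,c)X,I(a,c)Y)=\mathrm{Ric}(X,Y)$ for all $X,Y$. Let $s(a,c)$ be the scalar curvature of $g(a,c)$. 1. If $n=0$ or $p=0$, then for no $a\in\mathbb R$, $c>0$ is the Ricci tensor of $g(a,c)$ $I(a,c)$-Hermitian. 2. If $n\ne0$ and $p\ne0$, then the Ricci tensor of $g(0,\sqrt{n/p})$ is $I(0,\sqrt{n/p})$-Hermitian. 3. The scalar curvature $s(a,c)$ of $g(a,c)$ is constant on $M$ and is a differentiable function of $(a,c)\in\mathbb R\times(0,\infty)$. If $n=0$ or $p=0$, then $s$ has no critical point. If $n\ne0$ and $p\ne0$, then $(0,\sqrt{n/p})$ is the unique critical point of $s$, and $s$ attains its maximum there, with value $4n(n+1)+4p(p+1)-4\sqrt{np}$. -/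

import Mathlib

open scoped ContDiff

noncomputable section

namespace SphereProduct

/-- The space `ℂⁿ⁺¹ × ℂᵖ⁺¹`, on which `U(n+1) × U(p+1)` acts. -/
abbrev Ambient (n p : ℕ) : Type :=
  EuclideanSpace ℂ (Fin (n + 1)) × EuclideanSpace ℂ (Fin (p + 1))

variable {n p : ℕ}

/-- The manifold `S²ⁿ⁺¹ × S²ᵖ⁺¹ = U(n+1)/U(n) × U(p+1)/U(p)`, the orbit of `(e₀, e₀)`. -/
def manifold (n p : ℕ) : Set (Ambient n p) := {x | ‖x.1‖ = 1 ∧ ‖x.2‖ = 1}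

/-- The tangent space of `S²ⁿ⁺¹ × S²ᵖ⁺¹` at `x = (z, w)`: the pairs `(u, v)` with
`Re ⟨z, u⟩ = 0` and `Re ⟨w, v⟩ = 0`. -/
def tangent (x : Ambient n p) : Submodule ℝ (Ambient n p) where
  carrier := {v | (inner ℂ x.1 v.1).re = 0 ∧ (inner ℂ x.2 v.2).re = 0}
  zero_mem' := by simp
  add_mem' := by
    rintro u v ⟨h1, h2⟩ ⟨h3, h4⟩
    exact ⟨by rw [Prod.fst_add, inner_add_right, Complex.add_re, h1, h3, add_zero],
      by rw [Prod.snd_add, inner_add_right, Complex.add_re, h2, h4, add_zero]⟩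
  smul_mem' := by
    rintro r v ⟨h1, h2⟩
    have h : ∀ {m : ℕ} (z y : EuclideanSpace ℂ (Fin m)),
        (inner ℂ z (r • y)).re = r * (inner ℂ z y).re := by
      intro m z y
      rw [← Complex.coe_smul, inner_smul_right, Complex.re_ofReal_mul]
    exact ⟨by rw [Prod.smul_fst, h, h1, mul_zero], by rw [Prod.smul_snd, h, h2, mul_zero]⟩

/-! ### The invariant tensors

At the base point `(e₀, e₀)` the basis `X¹, Y¹₂ᵥ₋₁, Y¹₂ᵥ, X², Y²₂ᵥ₋₁, Y²₂ᵥ` of `𝔭` corresponds to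
the tangent vectors `(i e₀, 0), (eᵥ, 0), (i eᵥ, 0), (0, i e₀), (0, eᵥ), (0, i eᵥ)`. The tensors
below are `U(n+1) × U(p+1)`-equivariant and have the prescribed values there. -/

/-- For `z` on the unit sphere and `v` tangent at `z`, the coefficient of the invariant field
`i z` in the decomposition `v = vert z v • (i z) + horiz z v`. -/
def vert {m : ℕ} (z v : EuclideanSpace ℂ (Fin m)) : ℝ := (inner ℂ z v).im

/-- The component of `v` that is complex-orthogonal to the unit vector `z`. -/
def horiz {m : ℕ} (z v : EuclideanSpace ℂ (Fin m)) : EuclideanSpace ℂ (Fin m) :=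
  v - (inner ℂ z v : ℂ) • z

/-- The invariant complex structure `I(a,c)`:
`X¹ ↦ (a/c) X¹ + (1/c) X²`, `X² ↦ -((a² + c²)/c) X¹ - (a/c) X²`, and multiplication by `i` on the
horizontal vectors. -/
def cplx (a c : ℝ) (x v : Ambient n p) : Ambient n p :=
  ((a / c * vert x.1 v.1 - (a ^ 2 + c ^ 2) / c * vert x.2 v.2) • (Complex.I • x.1)
      + Complex.I • horiz x.1 v.1,
    (1 / c * vert x.1 v.1 - a / c * vert x.2 v.2) • (Complex.I • x.2)
      + Complex.I • horiz x.2 v.2)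

/-- The invariant 2-form `ω = X¹ ∧ X² + ∑ Y¹₂ᵥ₋₁ ∧ Y¹₂ᵥ + ∑ Y²₂ᵥ₋₁ ∧ Y²₂ᵥ`. -/
def omega (x u v : Ambient n p) : ℝ :=
  vert x.1 u.1 * vert x.2 v.2 - vert x.2 u.2 * vert x.1 v.1
    + (inner ℂ (horiz x.1 u.1) (horiz x.1 v.1)).im
    + (inner ℂ (horiz x.2 u.2) (horiz x.2 v.2)).im

/-- The associated metric `g(a,c)(u, v) = ω(u, I(a,c) v)`. -/
def metric (a c : ℝ) (x u v : Ambient n p) : ℝ := omega x u (cplx a c x v)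

/-! ### Riemannian geometry of the embedded submanifold

A smooth vector field on the closed submanifold `S²ⁿ⁺¹ × S²ᵖ⁺¹` is the restriction of a smooth map
of the ambient space which is tangent along the submanifold. All identities between fields are
required on the submanifold only, where they do not depend on the extensions. -/

/-- Smooth tangent vector fields. -/
structure IsField (X : Ambient n p → Ambient n p) : Prop where
  smooth : ContDiff ℝ ∞ X
  tangent : ∀ x ∈ manifold n p, X x ∈ tangent x

/-- `D` is the Levi-Civita connection of the Riemannian metric `g`, `D X Y = ∇_X Y`. -/
structure IsLeviCivita (g : Ambient n p → Ambient n p → Ambient n p → ℝ)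
    (D : (Ambient n p → Ambient n p) → (Ambient n p → Ambient n p) →
      (Ambient n p → Ambient n p)) : Prop where
  isField : ∀ X Y, IsField X → IsField Y → IsField (D X Y)
  add_left : ∀ X X' Y, IsField X → IsField X' → IsField Y →
    ∀ x ∈ manifold n p, D (X + X') Y x = D X Y x + D X' Y x
  smul_left : ∀ (f : Ambient n p → ℝ) X Y, ContDiff ℝ ∞ f → IsField X → IsField Y →
    ∀ x ∈ manifold n p, D (fun y => f y • X y) Y x = f x • D X Y x
  add_right : ∀ X Y Y', IsField X → IsField Y → IsField Y' →
    ∀ x ∈ manifold n p, D X (Y + Y') x = D X Y x + D X Y' x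
  leibniz : ∀ (f : Ambient n p → ℝ) X Y, ContDiff ℝ ∞ f → IsField X → IsField Y →
    ∀ x ∈ manifold n p,
      D X (fun y => f y • Y y) x = f x • D X Y x + fderiv ℝ f x (X x) • Y x
  torsion_free : ∀ X Y, IsField X → IsField Y →
    ∀ x ∈ manifold n p, D X Y x - D Y X x = VectorField.lieBracket ℝ X Y x
  metric_compatible : ∀ X Y Z, IsField X → IsField Y → IsField Z →
    ∀ x ∈ manifold n p,
      fderiv ℝ (fun y => g y (Y y) (Z y)) x (X x) = g x (D X Y x) (Z x) + g x (Y x) (D X Z x)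

/-- The curvature `R(X, Y) Z = ∇_X ∇_Y Z - ∇_Y ∇_X Z - ∇_[X,Y] Z` of a connection. -/
def curvature (D : (Ambient n p → Ambient n p) → (Ambient n p → Ambient n p) →
      (Ambient n p → Ambient n p)) (X Y Z : Ambient n p → Ambient n p) :
    Ambient n p → Ambient n p :=
  fun x => D X (D Y Z) x - D Y (D X Z) x - D (VectorField.lieBracket ℝ X Y) Z x

/-- `ρ` is the Ricci tensor of `g`: for the Levi-Civita connection of `g`, `ρ(Y, Z)` is at each
point the trace of the endomorphism `V ↦ R(V, Y) Z` of the tangent space. -/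
def IsRicciTensor (g ρ : Ambient n p → Ambient n p → Ambient n p → ℝ) : Prop :=
  ∃ D, IsLeviCivita g D ∧ ∀ Y Z, IsField Y → IsField Z → ∀ x ∈ manifold n p,
    ∃ A : tangent x →ₗ[ℝ] tangent x,
      (∀ (V : Ambient n p → Ambient n p) (v : tangent x), IsField V → V x = v →
        (A v : Ambient n p) = curvature D V Y Z x) ∧
      ρ x (Y x) (Z x) = LinearMap.trace ℝ (tangent x) A

/-- The bilinear form field `ρ` is Hermitian for the almost complex structure `J`. -/
def IsHermitian (J : Ambient n p → Ambient n p → Ambient n p)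
    (ρ : Ambient n p → Ambient n p → Ambient n p → ℝ) : Prop :=
  ∀ x ∈ manifold n p, ∀ u ∈ tangent x, ∀ v ∈ tangent x, ρ x (J x u) (J x v) = ρ x u v

/-- The scalar curvature of `g` is the constant `s`: the Ricci operator, i.e. the endomorphism `A`
with `g(A u, v) = Ric(u, v)`, has trace `s` at each point. -/
def HasScalarCurvature (g : Ambient n p → Ambient n p → Ambient n p → ℝ) (s : ℝ) : Prop :=
  ∃ ρ, IsRicciTensor g ρ ∧ ∀ x ∈ manifold n p,
    ∃ A : tangent x →ₗ[ℝ] tangent x,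
      (∀ u v : tangent x, g x (A u) v = ρ x u v) ∧ LinearMap.trace ℝ (tangent x) A = s

end SphereProduct

end

/-!
The metrics `g(a, c)` are the deformations `⟨·, ·⟩ + α θ₁² + 2β θ₁θ₂ + γ θ₂²` of the round product
metric, where `θ₁`, `θ₂` are the contact forms of the two spheres and
`α = 1/c - 1`, `β = -a/c`, `γ = (a² + c²)/c - 1` (`metric_eq_deformed`).

For such a metric the Levi-Civita connection can be written globally as `∇_X Y = dY(X) + S(X, Y)`,
with a Christoffel tensor `S` that depends polynomially on the point (`christoffel`,
`isLeviCivita_connection`). The curvature is then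
`R(u, v) w = (∂_u S)(v, w) - (∂_v S)(u, w) + S(u, S(v, w)) - S(v, S(u, w))`
(`curvature_connection`). As an operator in `u`, each of its diagonal blocks is a combination of the
identity, of multiplication by `i`, and of operators of rank one, up to multiples of the normal
vector, so that its trace on the tangent space can be read off (`trace_tangent`,
`trace_curvatureBlock`). Writing `G` for the Gram matrix of `X¹`, `X²`, the Ricci tensor is
`2n + 2 - 2G₁₁` and `2p + 2 - 2G₂₂` times the standard inner product on the two horizontal spaces,
and `2 G diag(n, p) G` on the vertical plane (`ricci`). Uniqueness of the Levi-Civita connection on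
the submanifold makes this the only Ricci tensor (`IsRicciTensor.eq_ricci`).

The horizontal part is always Hermitian. A symmetric form on the vertical plane is Hermitian only if
it is proportional to `G`, that is, if `diag(n, p) G` is a multiple of the identity: impossible when
`n` or `p` vanishes, and true for `a = 0`, `c² = n/p`. The trace of the Ricci operator gives
`s(a, c) = 4n(n + 1) + 4p(p + 1) - 2n/c - 2p(a² + c²)/c`, and the assertions on critical points and
on the maximum are elementary properties of this function.
-/

noncomputable section

namespace SphereProduct

variable {n p : ℕ}

/-! ### The real and imaginary parts of the Hermitian inner product -/

/-- The real inner product `Re ⟨u, v⟩`. -/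
def dot {m : ℕ} (u v : EuclideanSpace ℂ (Fin m)) : ℝ := (inner ℂ u v).re

section RealForms

variable {m : ℕ} (u u' v v' : EuclideanSpace ℂ (Fin m)) (r : ℝ)

theorem dot_add_left : dot (u + u') v = dot u v + dot u' v := by
  simp [dot]

theorem dot_add_right : dot u (v + v') = dot u v + dot u v' := by
  simp [dot]

theorem vert_add_left : vert (u + u') v = vert u v + vert u' v := by
  simp [vert]

theorem vert_add_right : vert u (v + v') = vert u v + vert u v' := by
  simp [vert]

theorem dot_smul_left : dot (r • u) v = r * dot u v := by
  rw [dot, ← Complex.coe_smul, inner_smul_left]; simp [dot]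

theorem dot_smul_right : dot u (r • v) = r * dot u v := by
  rw [dot, ← Complex.coe_smul, inner_smul_right]; simp [dot]

theorem vert_smul_left : vert (r • u) v = r * vert u v := by
  rw [vert, ← Complex.coe_smul, inner_smul_left]; simp [vert]

theorem vert_smul_right : vert u (r • v) = r * vert u v := by
  rw [vert, ← Complex.coe_smul, inner_smul_right]; simp [vert]

theorem dot_I_left : dot (Complex.I • u) v = vert u v := by
  simp [dot, vert]

theorem dot_I_right : dot u (Complex.I • v) = -vert u v := by
  simp [dot, vert]

theorem vert_I_left : vert (Complex.I • u) v = -dot u v := by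
  simp [dot, vert]

theorem vert_I_right : vert u (Complex.I • v) = dot u v := by
  simp [dot, vert]

theorem dot_comm : dot u v = dot v u := by
  rw [dot, dot, ← inner_conj_symm, Complex.conj_re]

theorem vert_swap : vert u v = -vert v u := by
  rw [vert, vert, ← inner_conj_symm, Complex.conj_im]

theorem vert_self : vert u u = 0 := by
  linarith [vert_swap u u]

theorem dot_self : dot u u = ‖u‖ ^ 2 := by
  rw [dot, inner_self_eq_norm_sq_to_K]; norm_cast

theorem dot_zero_left : dot 0 v = 0 := by simp [dot]

theorem dot_zero_right : dot u 0 = 0 := by simp [dot]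

theorem vert_zero_left : vert 0 v = 0 := by simp [vert]

theorem vert_zero_right : vert u 0 = 0 := by simp [vert]

theorem dot_neg_right : dot u (-v) = -dot u v := by simp [dot]

theorem dot_sub_right : dot u (v - v') = dot u v - dot u v' := by
  simp [dot]

theorem dot_sub_left : dot (u - u') v = dot u v - dot u' v := by
  simp [dot]

theorem vert_sub_right : vert u (v - v') = vert u v - vert u v' := by
  simp [vert]

theorem I_smul_I_smul : Complex.I • Complex.I • u = -u := by
  rw [smul_smul, Complex.I_mul_I, neg_one_smul]

theorem I_smul_real_smul : Complex.I • r • u = r • Complex.I • u := smul_comm _ _ _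

theorem vert_sub_left : vert (u - u') v = vert u v - vert u' v := by
  simp [vert]

/-- Tangency removes the real part of `⟨z, v⟩` from the horizontal projection. -/
theorem horiz_eq (h : dot u v = 0) : horiz u v = v - vert u v • (Complex.I • u) := by
  have : (inner ℂ u v : ℂ) = (vert u v : ℝ) * Complex.I := by
    apply Complex.ext <;> simp [vert]
    exact h
  rw [horiz, this, mul_smul, Complex.coe_smul]

theorem hasDerivAt_dot {f g : ℝ → EuclideanSpace ℂ (Fin m)} {f' g' : EuclideanSpace ℂ (Fin m)}
    {t : ℝ} (hf : HasDerivAt f f' t) (hg : HasDerivAt g g' t) :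
    HasDerivAt (fun s => dot (f s) (g s)) (dot f' (g t) + dot (f t) g') t := by
  have h := Complex.reCLM.hasFDerivAt.comp_hasDerivAt t (hf.inner ℂ hg)
  refine h.congr_deriv ?_
  simp [dot, add_comm]

theorem hasDerivAt_vert {f g : ℝ → EuclideanSpace ℂ (Fin m)} {f' g' : EuclideanSpace ℂ (Fin m)}
    {t : ℝ} (hf : HasDerivAt f f' t) (hg : HasDerivAt g g' t) :
    HasDerivAt (fun s => vert (f s) (g s)) (vert f' (g t) + vert (f t) g') t := by
  have h := Complex.imCLM.hasFDerivAt.comp_hasDerivAt t (hf.inner ℂ hg)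
  refine h.congr_deriv ?_
  simp [vert, add_comm]

theorem contDiff_dot {E : Type*} [NormedAddCommGroup E] [NormedSpace ℝ E]
    {f g : E → EuclideanSpace ℂ (Fin m)} (hf : ContDiff ℝ ∞ f) (hg : ContDiff ℝ ∞ g) :
    ContDiff ℝ ∞ (fun x => dot (f x) (g x)) :=
  Complex.reCLM.contDiff.comp (hf.inner ℂ hg)

theorem contDiff_vert {E : Type*} [NormedAddCommGroup E] [NormedSpace ℝ E]
    {f g : E → EuclideanSpace ℂ (Fin m)} (hf : ContDiff ℝ ∞ f) (hg : ContDiff ℝ ∞ g) :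
    ContDiff ℝ ∞ (fun x => vert (f x) (g x)) :=
  Complex.imCLM.contDiff.comp (hf.inner ℂ hg)

theorem contDiff_I_smul {E : Type*} [NormedAddCommGroup E] [NormedSpace ℝ E]
    {f : E → EuclideanSpace ℂ (Fin m)} (hf : ContDiff ℝ ∞ f) :
    ContDiff ℝ ∞ (fun x => Complex.I • f x) :=
  hf.const_smul Complex.I

end RealForms

/-! ### Tangent vectors -/

theorem hasDerivAt_fst {γ : ℝ → Ambient n p} {v : Ambient n p} {t : ℝ} (h : HasDerivAt γ v t) :
    HasDerivAt (fun s => (γ s).1) v.1 t :=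
  (ContinuousLinearMap.fst ℝ (EuclideanSpace ℂ (Fin (n + 1)))
    (EuclideanSpace ℂ (Fin (p + 1)))).hasFDerivAt.comp_hasDerivAt t h

theorem hasDerivAt_snd {γ : ℝ → Ambient n p} {v : Ambient n p} {t : ℝ} (h : HasDerivAt γ v t) :
    HasDerivAt (fun s => (γ s).2) v.2 t :=
  (ContinuousLinearMap.snd ℝ (EuclideanSpace ℂ (Fin (n + 1)))
    (EuclideanSpace ℂ (Fin (p + 1)))).hasFDerivAt.comp_hasDerivAt t h

theorem mem_tangent {x v : Ambient n p} :
    v ∈ tangent x ↔ dot x.1 v.1 = 0 ∧ dot x.2 v.2 = 0 := Iff.rfl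

theorem dot_self_of_mem {x : Ambient n p} (hx : x ∈ manifold n p) :
    dot x.1 x.1 = 1 ∧ dot x.2 x.2 = 1 := by
  simp [dot_self, hx.1, hx.2]

/-- Stereographic parametrization, with velocity `v` at `0`, of the great circle through the unit
vector `z` in the tangent direction `v`. -/
def circle {m : ℕ} (z v : EuclideanSpace ℂ (Fin m)) (t : ℝ) : EuclideanSpace ℂ (Fin m) :=
  (1 + t ^ 2 / 4 * dot v v)⁻¹ • ((1 - t ^ 2 / 4 * dot v v) • z + t • v)

theorem dot_self_nonneg {m : ℕ} (v : EuclideanSpace ℂ (Fin m)) : 0 ≤ dot v v := by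
  rw [dot_self]; positivity

theorem norm_circle {m : ℕ} {z v : EuclideanSpace ℂ (Fin m)} (hz : ‖z‖ = 1) (h : dot z v = 0)
    (t : ℝ) : ‖circle z v t‖ = 1 := by
  have hv := dot_self_nonneg v
  have hpos : 1 + t ^ 2 / 4 * dot v v ≠ 0 := by positivity
  have hz' : dot z z = 1 := by simp [dot_self, hz]
  have h' : dot v z = 0 := by rw [dot_comm, h]
  have : ‖circle z v t‖ ^ 2 = 1 := by
    rw [← dot_self]
    simp only [circle, dot_smul_left, dot_smul_right, dot_add_left, dot_add_right, h, h', hz']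
    field_simp
    ring
  exact (pow_eq_one_iff_of_nonneg (norm_nonneg _) two_ne_zero).1 this

theorem hasDerivAt_circle {m : ℕ} (z v : EuclideanSpace ℂ (Fin m)) :
    HasDerivAt (circle z v) v 0 := by
  have h1 : HasDerivAt (fun t : ℝ => t ^ 2 / 4 * dot v v) 0 0 := by
    have := ((hasDerivAt_pow 2 (0 : ℝ)).div_const 4).mul_const (dot v v)
    simpa using this
  have h2 : HasDerivAt (fun t : ℝ => (1 - t ^ 2 / 4 * dot v v) • z + t • v) v 0 := by
    refine (((h1.const_sub 1).smul_const z).add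
      ((hasDerivAt_id (0 : ℝ)).smul_const v)).congr_deriv ?_
    simp
  refine (((h1.const_add 1).inv (by simp)).smul h2).congr_deriv ?_
  simp

/-- Every tangent vector of the submanifold is the velocity of a curve in it. -/
theorem exists_curve {x v : Ambient n p} (hx : x ∈ manifold n p) (hv : v ∈ tangent x) :
    ∃ γ : ℝ → Ambient n p, γ 0 = x ∧ HasDerivAt γ v 0 ∧ ∀ t, γ t ∈ manifold n p := by
  rw [mem_tangent] at hv
  refine ⟨fun t => (circle x.1 v.1 t, circle x.2 v.2 t), ?_,
    (hasDerivAt_circle x.1 v.1).prodMk (hasDerivAt_circle x.2 v.2),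
    fun t => ⟨norm_circle hx.1 hv.1 t, norm_circle hx.2 hv.2 t⟩⟩
  simp [circle]

theorem fderiv_eq_of_hasDerivAt {E F : Type*} [NormedAddCommGroup E] [NormedSpace ℝ E]
    [NormedAddCommGroup F] [NormedSpace ℝ F] {f : E → F} {γ : ℝ → E} {x v : E} {w : F}
    (hf : DifferentiableAt ℝ f x) (h0 : γ 0 = x) (hγ : HasDerivAt γ v 0)
    (h : HasDerivAt (fun t => f (γ t)) w 0) : fderiv ℝ f x v = w := by
  subst h0
  exact (hf.hasFDerivAt.comp_hasDerivAt 0 hγ).unique h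

/-- Derivatives in tangential directions depend only on the values on the submanifold. -/
theorem fderiv_congr_on_manifold {F : Type*} [NormedAddCommGroup F] [NormedSpace ℝ F]
    {f g : Ambient n p → F} {x v : Ambient n p} (hf : DifferentiableAt ℝ f x)
    (hg : DifferentiableAt ℝ g x) (h : ∀ y ∈ manifold n p, f y = g y)
    (hx : x ∈ manifold n p) (hv : v ∈ tangent x) : fderiv ℝ f x v = fderiv ℝ g x v := by
  obtain ⟨γ, h0, hγ, hM⟩ := exists_curve hx hv
  refine fderiv_eq_of_hasDerivAt hf h0 hγ ?_
  have : (fun t => f (γ t)) = fun t => g (γ t) := funext fun t => h _ (hM t)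
  rw [this]
  subst h0
  exact hg.hasFDerivAt.comp_hasDerivAt 0 hγ

/-- Every tangent vector extends to a smooth tangent vector field. -/
theorem exists_field {x v : Ambient n p} (hv : v ∈ tangent x) : ∃ V, IsField V ∧ V x = v := by
  rw [mem_tangent] at hv
  refine ⟨fun y => v - (dot y.1 v.1 • y.1, dot y.2 v.2 • y.2), ⟨?_, ?_⟩, ?_⟩
  · exact contDiff_const.sub (((contDiff_dot contDiff_fst contDiff_const).smul contDiff_fst).prodMk
      ((contDiff_dot contDiff_snd contDiff_const).smul contDiff_snd))
  · intro y hy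
    obtain ⟨h1, h2⟩ := dot_self_of_mem hy
    rw [mem_tangent]
    simp [dot_sub_right, dot_smul_right, h1, h2]
  · simp [hv.1, hv.2]

/-- Differentiating `Re ⟨x, Y⟩ = 0` along the submanifold. -/
theorem IsField.dot_fderiv {X Y : Ambient n p → Ambient n p} (hY : IsField Y) (hX : IsField X)
    {x : Ambient n p} (hx : x ∈ manifold n p) :
    dot x.1 (fderiv ℝ Y x (X x)).1 = -dot (X x).1 (Y x).1 ∧
      dot x.2 (fderiv ℝ Y x (X x)).2 = -dot (X x).2 (Y x).2 := by
  obtain ⟨γ, h0, hγ, hM⟩ := exists_curve hx (hX.tangent x hx)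
  have hd : DifferentiableAt ℝ Y (γ 0) := hY.smooth.contDiffAt.differentiableAt (by simp)
  have hYγ := hd.hasFDerivAt.comp_hasDerivAt 0 hγ
  rw [h0] at hYγ
  have e1 := hasDerivAt_dot (hasDerivAt_fst hγ) (hasDerivAt_fst hYγ)
  have e2 := hasDerivAt_dot (hasDerivAt_snd hγ) (hasDerivAt_snd hYγ)
  have z1 : (fun s => dot (γ s).1 ((Y ∘ γ) s).1) = fun _ => 0 :=
    funext fun t => (hY.tangent _ (hM t)).1
  have z2 : (fun s => dot (γ s).2 ((Y ∘ γ) s).2) = fun _ => 0 :=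
    funext fun t => (hY.tangent _ (hM t)).2
  rw [z1] at e1
  rw [z2] at e2
  have f1 := e1.unique (hasDerivAt_const _ _)
  have f2 := e2.unique (hasDerivAt_const _ _)
  simp only [Function.comp_apply, h0] at f1 f2
  constructor <;> linarith

theorem IsField.lieBracket {X Y : Ambient n p → Ambient n p} (hX : IsField X) (hY : IsField Y) :
    IsField (VectorField.lieBracket ℝ X Y) := by
  refine ⟨?_, fun x hx => ?_⟩
  · exact ((hY.smooth.fderiv_right (by simp)).clm_apply hX.smooth).sub
      ((hX.smooth.fderiv_right (by simp)).clm_apply hY.smooth)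
  · rw [mem_tangent]
    have h1 := hY.dot_fderiv hX hx
    have h2 := hX.dot_fderiv hY hx
    simp only [VectorField.lieBracket, Prod.fst_sub, Prod.snd_sub, dot_sub_right, h1, h2]
    rw [dot_comm (X x).1, dot_comm (X x).2]
    simp

/-! ### The connection -/

/-- One spherical factor of the Christoffel tensor at `x`; the numbers `b`, `b'` are the values at
`u`, `v` of the one-form `β` attached to that factor. The summand `⟨u, v⟩ x` is the second
fundamental form of the unit sphere, the remaining ones turn its round Levi-Civita connection into
that of the deformed metric. -/
def sphereChristoffel {m : ℕ} (x u v : EuclideanSpace ℂ (Fin m)) (b b' : ℝ) :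
    EuclideanSpace ℂ (Fin m) :=
  b' • (Complex.I • u) + b • (Complex.I • v) + (dot u v + b' * vert x u + b * vert x v) • x

/-- The tensor `S` for which `∇_X Y = dY(X) + S(X, Y)` is the Levi-Civita connection of
`⟨·, ·⟩ + α θ₁² + 2β θ₁θ₂ + γ θ₂²`, where `θᵢ = vert xᵢ` are the contact forms of the spheres. -/
def christoffel (α β γ : ℝ) (x u v : Ambient n p) : Ambient n p :=
  (sphereChristoffel x.1 u.1 v.1 (α * vert x.1 u.1 + β * vert x.2 u.2)
      (α * vert x.1 v.1 + β * vert x.2 v.2),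
    sphereChristoffel x.2 u.2 v.2 (β * vert x.1 u.1 + γ * vert x.2 u.2)
      (β * vert x.1 v.1 + γ * vert x.2 v.2))

/-- The derivative at `x` in the direction `w` of the Christoffel tensor, on fixed vectors. -/
def christoffelDeriv (α β γ : ℝ) (x w u v : Ambient n p) : Ambient n p :=
  ((α * vert w.1 v.1 + β * vert w.2 v.2) • (Complex.I • u.1)
      + (α * vert w.1 u.1 + β * vert w.2 u.2) • (Complex.I • v.1)
      + (dot u.1 v.1 + (α * vert x.1 v.1 + β * vert x.2 v.2) * vert x.1 u.1
        + (α * vert x.1 u.1 + β * vert x.2 u.2) * vert x.1 v.1) • w.1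
      + ((α * vert w.1 v.1 + β * vert w.2 v.2) * vert x.1 u.1
        + (α * vert x.1 v.1 + β * vert x.2 v.2) * vert w.1 u.1
        + (α * vert w.1 u.1 + β * vert w.2 u.2) * vert x.1 v.1
        + (α * vert x.1 u.1 + β * vert x.2 u.2) * vert w.1 v.1) • x.1,
    (β * vert w.1 v.1 + γ * vert w.2 v.2) • (Complex.I • u.2)
      + (β * vert w.1 u.1 + γ * vert w.2 u.2) • (Complex.I • v.2)
      + (dot u.2 v.2 + (β * vert x.1 v.1 + γ * vert x.2 v.2) * vert x.2 u.2
        + (β * vert x.1 u.1 + γ * vert x.2 u.2) * vert x.2 v.2) • w.2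
      + ((β * vert w.1 v.1 + γ * vert w.2 v.2) * vert x.2 u.2
        + (β * vert x.1 v.1 + γ * vert x.2 v.2) * vert w.2 u.2
        + (β * vert w.1 u.1 + γ * vert w.2 u.2) * vert x.2 v.2
        + (β * vert x.1 u.1 + γ * vert x.2 u.2) * vert w.2 v.2) • x.2)

section

variable (α β γ : ℝ) (x u u' v v' : Ambient n p) (r : ℝ)

theorem christoffel_comm : christoffel α β γ x u v = christoffel α β γ x v u := by
  ext1 <;> simp only [christoffel, sphereChristoffel]
  · rw [dot_comm u.1]; module
  · rw [dot_comm u.2]; module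

theorem christoffel_add_right :
    christoffel α β γ x u (v + v') = christoffel α β γ x u v + christoffel α β γ x u v' := by
  ext1 <;> simp only [christoffel, sphereChristoffel, Prod.fst_add, Prod.snd_add, vert_add_right,
    dot_add_right, smul_add] <;> module

theorem christoffel_smul_right :
    christoffel α β γ x u (r • v) = r • christoffel α β γ x u v := by
  ext1 <;> simp only [christoffel, sphereChristoffel, Prod.smul_fst, Prod.smul_snd,
    vert_smul_right, dot_smul_right, I_smul_real_smul] <;> module

theorem christoffel_add_left :
    christoffel α β γ x (u + u') v = christoffel α β γ x u v + christoffel α β γ x u' v := by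
  simp only [christoffel_comm _ _ _ _ _ v, christoffel_add_right]

theorem christoffel_smul_left :
    christoffel α β γ x (r • u) v = r • christoffel α β γ x u v := by
  simp only [christoffel_comm _ _ _ _ _ v, christoffel_smul_right]

theorem christoffel_sub_left :
    christoffel α β γ x (u - u') v = christoffel α β γ x u v - christoffel α β γ x u' v := by
  rw [eq_sub_iff_add_eq, ← christoffel_add_left, sub_add_cancel]

end

section

variable {E : Type*} [NormedAddCommGroup E] [NormedSpace ℝ E]

theorem contDiff_sphereChristoffel {m : ℕ} {f g h : E → EuclideanSpace ℂ (Fin m)} {b b' : E → ℝ}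
    (hf : ContDiff ℝ ∞ f) (hg : ContDiff ℝ ∞ g) (hh : ContDiff ℝ ∞ h) (hb : ContDiff ℝ ∞ b)
    (hb' : ContDiff ℝ ∞ b') :
    ContDiff ℝ ∞ (fun t => sphereChristoffel (f t) (g t) (h t) (b t) (b' t)) :=
  ((hb'.smul (contDiff_I_smul hg)).add (hb.smul (contDiff_I_smul hh))).add
    ((((contDiff_dot hg hh).add (hb'.mul (contDiff_vert hf hg))).add
      (hb.mul (contDiff_vert hf hh))).smul hf)

theorem contDiff_oneForm (α β : ℝ) {f g : E → Ambient n p}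
    (hf : ContDiff ℝ ∞ f) (hg : ContDiff ℝ ∞ g) :
    ContDiff ℝ ∞ (fun t => α * vert (f t).1 (g t).1 + β * vert (f t).2 (g t).2) :=
  (contDiff_const.mul (contDiff_vert hf.fst hg.fst)).add
    (contDiff_const.mul (contDiff_vert hf.snd hg.snd))

theorem contDiff_christoffel (α β γ : ℝ) {f g h : E → Ambient n p}
    (hf : ContDiff ℝ ∞ f) (hg : ContDiff ℝ ∞ g) (hh : ContDiff ℝ ∞ h) :
    ContDiff ℝ ∞ (fun t => christoffel α β γ (f t) (g t) (h t)) :=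
  (contDiff_sphereChristoffel hf.fst hg.fst hh.fst (contDiff_oneForm α β hf hg)
    (contDiff_oneForm α β hf hh)).prodMk
    (contDiff_sphereChristoffel hf.snd hg.snd hh.snd (contDiff_oneForm β γ hf hg)
      (contDiff_oneForm β γ hf hh))

theorem hasDerivAt_oneForm (α β : ℝ) {f g : ℝ → Ambient n p} {f' g' : Ambient n p} {t : ℝ}
    (hf : HasDerivAt f f' t) (hg : HasDerivAt g g' t) :
    HasDerivAt (fun s => α * vert (f s).1 (g s).1 + β * vert (f s).2 (g s).2)
      ((α * vert f'.1 (g t).1 + β * vert f'.2 (g t).2)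
        + (α * vert (f t).1 g'.1 + β * vert (f t).2 g'.2)) t := by
  refine (((hasDerivAt_vert (hasDerivAt_fst hf) (hasDerivAt_fst hg)).const_mul α).add
    ((hasDerivAt_vert (hasDerivAt_snd hf) (hasDerivAt_snd hg)).const_mul β)).congr_deriv ?_
  ring

theorem hasDerivAt_sphereChristoffel {m : ℕ} {f g h : ℝ → EuclideanSpace ℂ (Fin m)} {b c : ℝ → ℝ}
    {f' g' h' : EuclideanSpace ℂ (Fin m)} {b' c' t : ℝ}
    (hf : HasDerivAt f f' t) (hg : HasDerivAt g g' t) (hh : HasDerivAt h h' t)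
    (hb : HasDerivAt b b' t) (hc : HasDerivAt c c' t) :
    HasDerivAt (fun s => sphereChristoffel (f s) (g s) (h s) (b s) (c s))
      (c' • (Complex.I • g t) + c t • (Complex.I • g') + b' • (Complex.I • h t)
        + b t • (Complex.I • h') + (dot g' (h t) + dot (g t) h' + c' * vert (f t) (g t)
          + c t * (vert f' (g t) + vert (f t) g') + b' * vert (f t) (h t)
          + b t * (vert f' (h t) + vert (f t) h')) • f t
        + (dot (g t) (h t) + c t * vert (f t) (g t) + b t * vert (f t) (h t)) • f') t := by
  refine (((hc.smul (hg.const_smul Complex.I)).add (hb.smul (hh.const_smul Complex.I))).add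
    ((((hasDerivAt_dot hg hh).add (hc.mul (hasDerivAt_vert hf hg))).add
      (hb.mul (hasDerivAt_vert hf hh))).smul hf)).congr_deriv ?_
  simp only [Pi.add_apply, Pi.mul_apply, Pi.smul_apply]
  module

theorem hasDerivAt_christoffel (α β γ : ℝ) {f g h : ℝ → Ambient n p} {f' g' h' : Ambient n p}
    {t : ℝ} (hf : HasDerivAt f f' t) (hg : HasDerivAt g g' t) (hh : HasDerivAt h h' t) :
    HasDerivAt (fun s => christoffel α β γ (f s) (g s) (h s))
      (christoffelDeriv α β γ (f t) f' (g t) (h t) + christoffel α β γ (f t) g' (h t)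
        + christoffel α β γ (f t) (g t) h') t := by
  refine ((hasDerivAt_sphereChristoffel (hasDerivAt_fst hf) (hasDerivAt_fst hg)
    (hasDerivAt_fst hh) (hasDerivAt_oneForm α β hf hg) (hasDerivAt_oneForm α β hf hh)).prodMk
    (hasDerivAt_sphereChristoffel (hasDerivAt_snd hf) (hasDerivAt_snd hg)
      (hasDerivAt_snd hh) (hasDerivAt_oneForm β γ hf hg)
      (hasDerivAt_oneForm β γ hf hh))).congr_deriv ?_
  ext1 <;> simp only [christoffel, christoffelDeriv, sphereChristoffel, Prod.fst_add,
    Prod.snd_add] <;> module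

end

/-- The connection `∇_X Y = dY(X) + S(X, Y)` on the ambient space. -/
def connection (α β γ : ℝ) (X Y : Ambient n p → Ambient n p) (x : Ambient n p) : Ambient n p :=
  fderiv ℝ Y x (X x) + christoffel α β γ x (X x) (Y x)

theorem contDiff_connection (α β γ : ℝ) {X Y : Ambient n p → Ambient n p}
    (hX : ContDiff ℝ ∞ X) (hY : ContDiff ℝ ∞ Y) : ContDiff ℝ ∞ (connection α β γ X Y) :=
  ((hY.fderiv_right (by simp)).clm_apply hX).add (contDiff_christoffel α β γ contDiff_id hX hY)

theorem hasDerivAt_line {E F : Type*} [NormedAddCommGroup E] [NormedSpace ℝ E]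
    [NormedAddCommGroup F] [NormedSpace ℝ F] {f : E → F} (hf : ContDiff ℝ ∞ f) (x w : E) :
    HasDerivAt (fun t : ℝ => f (x + t • w)) (fderiv ℝ f x w) 0 := by
  have hl : HasDerivAt (fun t : ℝ => x + t • w) w 0 := by
    simpa using ((hasDerivAt_id (0 : ℝ)).smul_const w).const_add x
  have hd : DifferentiableAt ℝ f (x + (0 : ℝ) • w) := hf.contDiffAt.differentiableAt (by simp)
  refine (hd.hasFDerivAt.comp_hasDerivAt 0 hl).congr_deriv ?_
  simp

theorem fderiv_fderiv_apply {E : Type*} [NormedAddCommGroup E] [NormedSpace ℝ E] {Z W : E → E}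
    (hZ : ContDiff ℝ ∞ Z) (hW : ContDiff ℝ ∞ W) (x v : E) :
    fderiv ℝ (fun y => fderiv ℝ Z y (W y)) x v =
      fderiv ℝ (fderiv ℝ Z) x v (W x) + fderiv ℝ Z x (fderiv ℝ W x v) := by
  have hdZ : ContDiff ℝ ∞ (fderiv ℝ Z) := hZ.fderiv_right (by simp)
  rw [fderiv_clm_apply (hdZ.contDiffAt.differentiableAt (by simp))
    (hW.contDiffAt.differentiableAt (by simp))]
  exact add_comm _ _

theorem fderiv_christoffel (α β γ : ℝ) {Y Z : Ambient n p → Ambient n p}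
    (hY : ContDiff ℝ ∞ Y) (hZ : ContDiff ℝ ∞ Z) (x w : Ambient n p) :
    fderiv ℝ (fun y => christoffel α β γ y (Y y) (Z y)) x w =
      christoffelDeriv α β γ x w (Y x) (Z x) + christoffel α β γ x (fderiv ℝ Y x w) (Z x)
        + christoffel α β γ x (Y x) (fderiv ℝ Z x w) := by
  have h1 := hasDerivAt_line (contDiff_christoffel α β γ contDiff_id hY hZ) x w
  have h2 := hasDerivAt_christoffel α β γ (hasDerivAt_line contDiff_id x w)
    (hasDerivAt_line hY x w) (hasDerivAt_line hZ x w)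
  simpa using h1.unique h2

/-- The second derivatives of `Z` cancel, and the curvature becomes an algebraic expression in the
Christoffel tensor and its first derivative. -/
theorem curvature_connection (α β γ : ℝ) {X Y Z : Ambient n p → Ambient n p}
    (hX : ContDiff ℝ ∞ X) (hY : ContDiff ℝ ∞ Y) (hZ : ContDiff ℝ ∞ Z) (x : Ambient n p) :
    curvature (connection α β γ) X Y Z x =
      christoffelDeriv α β γ x (X x) (Y x) (Z x) - christoffelDeriv α β γ x (Y x) (X x) (Z x)
        + christoffel α β γ x (X x) (christoffel α β γ x (Y x) (Z x))
        - christoffel α β γ x (Y x) (christoffel α β γ x (X x) (Z x)) := by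
  have key : ∀ {V W : Ambient n p → Ambient n p}, ContDiff ℝ ∞ V → ContDiff ℝ ∞ W →
      connection α β γ V (connection α β γ W Z) x =
        fderiv ℝ (fderiv ℝ Z) x (V x) (W x) + fderiv ℝ Z x (fderiv ℝ W x (V x))
        + christoffelDeriv α β γ x (V x) (W x) (Z x)
        + christoffel α β γ x (fderiv ℝ W x (V x)) (Z x)
        + christoffel α β γ x (W x) (fderiv ℝ Z x (V x))
        + christoffel α β γ x (V x) (fderiv ℝ Z x (W x))
        + christoffel α β γ x (V x) (christoffel α β γ x (W x) (Z x)) := by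
    intro V W hV hW
    have hdZ : ContDiff ℝ ∞ (fderiv ℝ Z) := hZ.fderiv_right (by simp)
    have h1 : DifferentiableAt ℝ (fun y => fderiv ℝ Z y (W y)) x :=
      (hdZ.clm_apply hW).contDiffAt.differentiableAt (by simp)
    have h2 : DifferentiableAt ℝ (fun y => christoffel α β γ y (W y) (Z y)) x :=
      (contDiff_christoffel α β γ contDiff_id hW hZ).contDiffAt.differentiableAt (by simp)
    have h3 : fderiv ℝ (connection α β γ W Z) x (V x) =
        fderiv ℝ (fun y => fderiv ℝ Z y (W y)) x (V x)
          + fderiv ℝ (fun y => christoffel α β γ y (W y) (Z y)) x (V x) := by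
      have : connection α β γ W Z = (fun y => fderiv ℝ Z y (W y))
        + fun y => christoffel α β γ y (W y) (Z y) := rfl
      rw [this, fderiv_add h1 h2]; rfl
    rw [connection, h3, fderiv_fderiv_apply hZ hW, fderiv_christoffel α β γ hW hZ,
      connection, christoffel_add_right]
    abel
  have hs : fderiv ℝ (fderiv ℝ Z) x (X x) (Y x) = fderiv ℝ (fderiv ℝ Z) x (Y x) (X x) :=
    ((contDiff_infty.1 hZ 2).contDiffAt.isSymmSndFDerivAt (by simp)) _ _
  rw [curvature, key hX hY, key hY hX, connection, VectorField.lieBracket, map_sub,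
    christoffel_sub_left, hs]
  abel

/-! ### The Levi-Civita connection -/

/-- The metric `⟨·, ·⟩ + α θ₁² + 2β θ₁θ₂ + γ θ₂²`, as a form on all of the ambient space. -/
def deformed (α β γ : ℝ) (x u v : Ambient n p) : ℝ :=
  dot u.1 v.1 + dot u.2 v.2 + (α * vert x.1 u.1 + β * vert x.2 u.2) * vert x.1 v.1
    + (β * vert x.1 u.1 + γ * vert x.2 u.2) * vert x.2 v.2

theorem metric_eq_deformed {a c : ℝ} (hc : 0 < c) {x u v : Ambient n p} (hx : x ∈ manifold n p)
    (hu : u ∈ tangent x) (hv : v ∈ tangent x) :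
    metric a c x u v = deformed (1 / c - 1) (-a / c) ((a ^ 2 + c ^ 2) / c - 1) x u v := by
  obtain ⟨x1, x2⟩ := dot_self_of_mem hx
  rw [mem_tangent] at hu hv
  obtain ⟨u1, u2⟩ := hu
  obtain ⟨v1, v2⟩ := hv
  have im_eq : ∀ {m : ℕ} (y z : EuclideanSpace ℂ (Fin m)), (inner ℂ y z).im = vert y z :=
    fun _ _ => rfl
  have w1 : dot x.1 (cplx a c x v).1 = 0 := by
    simp only [cplx, horiz_eq _ _ v1, dot_add_right, dot_smul_right, dot_I_right, vert_self,
      vert_sub_right, vert_smul_right, vert_I_right, x1]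
    ring
  have w2 : dot x.2 (cplx a c x v).2 = 0 := by
    simp only [cplx, horiz_eq _ _ v2, dot_add_right, dot_smul_right, dot_I_right, vert_self,
      vert_sub_right, vert_smul_right, vert_I_right, x2]
    ring
  simp only [metric, omega, horiz_eq _ _ u1, horiz_eq _ _ u2, horiz_eq _ _ w1, horiz_eq _ _ w2,
    im_eq]
  simp only [cplx, horiz_eq _ _ v1, horiz_eq _ _ v2, deformed]
  simp only [vert_add_right, vert_sub_right, vert_sub_left, vert_smul_left, vert_smul_right,
    vert_I_left, vert_I_right, vert_self, dot_sub_left, dot_sub_right, dot_smul_left,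
    dot_smul_right, dot_I_left, dot_I_right, x1, x2, v1, v2, vert_swap u.1 x.1, vert_swap u.2 x.2]
  field_simp
  ring

theorem christoffel_fst_dot {α β γ : ℝ} {x : Ambient n p} (hx : x ∈ manifold n p)
    (u v : Ambient n p) :
    dot x.1 (christoffel α β γ x u v).1 = dot u.1 v.1 := by
  simp only [christoffel, sphereChristoffel, dot_add_right, dot_smul_right, dot_I_right,
    (dot_self_of_mem hx).1]
  ring

theorem christoffel_snd_dot {α β γ : ℝ} {x : Ambient n p} (hx : x ∈ manifold n p)
    (u v : Ambient n p) :
    dot x.2 (christoffel α β γ x u v).2 = dot u.2 v.2 := by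
  simp only [christoffel, sphereChristoffel, dot_add_right, dot_smul_right, dot_I_right,
    (dot_self_of_mem hx).2]
  ring

theorem christoffel_fst_vert {α β γ : ℝ} {x u v : Ambient n p} (hu : u ∈ tangent x)
    (hv : v ∈ tangent x) : vert x.1 (christoffel α β γ x u v).1 = 0 := by
  rw [mem_tangent] at hu hv
  simp [christoffel, sphereChristoffel, vert_add_right, vert_smul_right, vert_I_right, vert_self,
    hu.1, hv.1]

theorem christoffel_snd_vert {α β γ : ℝ} {x u v : Ambient n p} (hu : u ∈ tangent x)
    (hv : v ∈ tangent x) : vert x.2 (christoffel α β γ x u v).2 = 0 := by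
  rw [mem_tangent] at hu hv
  simp [christoffel, sphereChristoffel, vert_add_right, vert_smul_right, vert_I_right, vert_self,
    hu.2, hv.2]

theorem isField_connection (α β γ : ℝ) {X Y : Ambient n p → Ambient n p} (hX : IsField X)
    (hY : IsField Y) : IsField (connection α β γ X Y) := by
  refine ⟨contDiff_connection α β γ hX.smooth hY.smooth, fun x hx => ?_⟩
  have h := hY.dot_fderiv hX hx
  rw [mem_tangent]
  simp only [connection, Prod.fst_add, Prod.snd_add, dot_add_right, h, christoffel_fst_dot hx,
    christoffel_snd_dot hx]
  simp

theorem deformed_add_left (α β γ : ℝ) (x u u' v : Ambient n p) :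
    deformed α β γ x (u + u') v = deformed α β γ x u v + deformed α β γ x u' v := by
  simp only [deformed, Prod.fst_add, Prod.snd_add, dot_add_left, vert_add_right]
  ring

theorem deformed_comm (α β γ : ℝ) (x u v : Ambient n p) :
    deformed α β γ x u v = deformed α β γ x v u := by
  simp only [deformed, dot_comm u.1, dot_comm u.2]
  ring

/-- The part of `⟨∇_X Y, Z⟩` carried by the Christoffel tensor. -/
theorem deformed_christoffel {α β γ : ℝ} {x u v w : Ambient n p} (hu : u ∈ tangent x)
    (hv : v ∈ tangent x) (hw : w ∈ tangent x) :
    deformed α β γ x (christoffel α β γ x u v) w =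
      (α * vert x.1 v.1 + β * vert x.2 v.2) * vert u.1 w.1
        + (α * vert x.1 u.1 + β * vert x.2 u.2) * vert v.1 w.1
        + (β * vert x.1 v.1 + γ * vert x.2 v.2) * vert u.2 w.2
        + (β * vert x.1 u.1 + γ * vert x.2 u.2) * vert v.2 w.2 := by
  rw [deformed, christoffel_fst_vert hu hv, christoffel_snd_vert hu hv]
  rw [mem_tangent] at hw
  simp only [christoffel, sphereChristoffel, dot_add_left, dot_smul_left, dot_I_left, hw.1, hw.2]
  ring

theorem hasDerivAt_deformed (α β γ : ℝ) {f g h : ℝ → Ambient n p} {f' g' h' : Ambient n p}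
    {t : ℝ} (hf : HasDerivAt f f' t) (hg : HasDerivAt g g' t) (hh : HasDerivAt h h' t) :
    HasDerivAt (fun s => deformed α β γ (f s) (g s) (h s))
      (deformed α β γ (f t) g' (h t) + deformed α β γ (f t) (g t) h'
        + (α * vert f'.1 (g t).1 + β * vert f'.2 (g t).2) * vert (f t).1 (h t).1
        + (α * vert (f t).1 (g t).1 + β * vert (f t).2 (g t).2) * vert f'.1 (h t).1
        + (β * vert f'.1 (g t).1 + γ * vert f'.2 (g t).2) * vert (f t).2 (h t).2
        + (β * vert (f t).1 (g t).1 + γ * vert (f t).2 (g t).2) * vert f'.2 (h t).2) t := by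
  have f1 := hasDerivAt_fst hf
  have f2 := hasDerivAt_snd hf
  have g1 := hasDerivAt_fst hg
  have g2 := hasDerivAt_snd hg
  have h1 := hasDerivAt_fst hh
  have h2 := hasDerivAt_snd hh
  refine ((((hasDerivAt_dot g1 h1).add (hasDerivAt_dot g2 h2)).add
    ((hasDerivAt_oneForm α β hf hg).mul (hasDerivAt_vert f1 h1))).add
    ((hasDerivAt_oneForm β γ hf hg).mul (hasDerivAt_vert f2 h2))).congr_deriv ?_
  simp only [deformed]
  ring

theorem contDiff_deformed (α β γ : ℝ) {E : Type*} [NormedAddCommGroup E] [NormedSpace ℝ E]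
    {f g h : E → Ambient n p}
    (hf : ContDiff ℝ ∞ f) (hg : ContDiff ℝ ∞ g) (hh : ContDiff ℝ ∞ h) :
    ContDiff ℝ ∞ (fun t => deformed α β γ (f t) (g t) (h t)) :=
  (((contDiff_dot hg.fst hh.fst).add (contDiff_dot hg.snd hh.snd)).add
    ((contDiff_oneForm α β hf hg).mul (contDiff_vert hf.fst hh.fst))).add
    ((contDiff_oneForm β γ hf hg).mul (contDiff_vert hf.snd hh.snd))

theorem contDiff_horiz {m : ℕ} {E : Type*} [NormedAddCommGroup E] [NormedSpace ℝ E]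
    {f g : E → EuclideanSpace ℂ (Fin m)} (hf : ContDiff ℝ ∞ f) (hg : ContDiff ℝ ∞ g) :
    ContDiff ℝ ∞ (fun t => horiz (f t) (g t)) :=
  hg.sub ((hf.inner ℂ hg).smul hf)

theorem contDiff_cplx (a c : ℝ) {E : Type*} [NormedAddCommGroup E] [NormedSpace ℝ E]
    {f g : E → Ambient n p} (hf : ContDiff ℝ ∞ f) (hg : ContDiff ℝ ∞ g) :
    ContDiff ℝ ∞ (fun t => cplx a c (f t) (g t)) := by
  have v1 := contDiff_vert hf.fst hg.fst
  have v2 := contDiff_vert hf.snd hg.snd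
  exact ((((contDiff_const.mul v1).sub (contDiff_const.mul v2)).smul
      (contDiff_I_smul hf.fst)).add (contDiff_I_smul (contDiff_horiz hf.fst hg.fst))).prodMk
    ((((contDiff_const.mul v1).sub (contDiff_const.mul v2)).smul
      (contDiff_I_smul hf.snd)).add (contDiff_I_smul (contDiff_horiz hf.snd hg.snd)))

theorem contDiff_metric (a c : ℝ) {E : Type*} [NormedAddCommGroup E] [NormedSpace ℝ E]
    {f g h : E → Ambient n p}
    (hf : ContDiff ℝ ∞ f) (hg : ContDiff ℝ ∞ g) (hh : ContDiff ℝ ∞ h) :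
    ContDiff ℝ ∞ (fun t => metric a c (f t) (g t) (h t)) := by
  have hJ := contDiff_cplx a c hf hh
  exact ((((contDiff_vert hf.fst hg.fst).mul (contDiff_vert hf.snd hJ.snd)).sub
    ((contDiff_vert hf.snd hg.snd).mul (contDiff_vert hf.fst hJ.fst))).add
    (contDiff_vert (contDiff_horiz hf.fst hg.fst) (contDiff_horiz hf.fst hJ.fst))).add
    (contDiff_vert (contDiff_horiz hf.snd hg.snd) (contDiff_horiz hf.snd hJ.snd))

theorem fderiv_deformed {α β γ : ℝ} {X Y Z : Ambient n p → Ambient n p} (hX : IsField X)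
    (hY : IsField Y) (hZ : IsField Z) {x : Ambient n p} (hx : x ∈ manifold n p) :
    fderiv ℝ (fun y => deformed α β γ y (Y y) (Z y)) x (X x) =
      deformed α β γ x (connection α β γ X Y x) (Z x)
        + deformed α β γ x (Y x) (connection α β γ X Z x) := by
  have h1 := hasDerivAt_line (contDiff_deformed α β γ contDiff_id hY.smooth hZ.smooth) x (X x)
  have h2 := hasDerivAt_deformed α β γ (hasDerivAt_line contDiff_id x (X x))
    (hasDerivAt_line hY.smooth x (X x)) (hasDerivAt_line hZ.smooth x (X x))
  have h3 := h1.unique h2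
  simp only [id_eq, fderiv_id, ContinuousLinearMap.id_apply, zero_smul, add_zero] at h3
  refine h3.trans ?_
  have tX := hX.tangent x hx
  have tY := hY.tangent x hx
  have tZ := hZ.tangent x hx
  rw [deformed_comm α β γ x (Y x) (connection α β γ X Z x), connection, connection,
    deformed_add_left, deformed_add_left,
    deformed_christoffel tX tY tZ, deformed_christoffel tX tZ tY,
    deformed_comm α β γ x (fderiv ℝ Z x (X x)) (Y x), vert_swap (Z x).1 (Y x).1,
    vert_swap (Z x).2 (Y x).2]
  ring

/-- The difference of two Levi-Civita connections is symmetric in its arguments and skew with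
respect to the metric, hence zero: this is the only place where positivity is needed. -/
theorem IsLeviCivita.unique {g : Ambient n p → Ambient n p → Ambient n p → ℝ}
    (hsub : ∀ x ∈ manifold n p, ∀ u ∈ tangent x, ∀ u' ∈ tangent x, ∀ v ∈ tangent x,
      g x (u - u') v = g x u v - g x u' v)
    (hcomm : ∀ x ∈ manifold n p, ∀ u ∈ tangent x, ∀ v ∈ tangent x, g x u v = g x v u)
    (hpos : ∀ x ∈ manifold n p, ∀ u ∈ tangent x, g x u u = 0 → u = 0)
    {D D' : (Ambient n p → Ambient n p) → (Ambient n p → Ambient n p) →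
      (Ambient n p → Ambient n p)} (hD : IsLeviCivita g D) (hD' : IsLeviCivita g D')
    {X Y : Ambient n p → Ambient n p} (hX : IsField X) (hY : IsField Y) {x : Ambient n p}
    (hx : x ∈ manifold n p) : D X Y x = D' X Y x := by
  have symm : ∀ X Y, IsField X → IsField Y → D X Y x - D' X Y x = D Y X x - D' Y X x := by
    intro X Y hX hY
    have h := (hD.torsion_free X Y hX hY x hx).trans (hD'.torsion_free X Y hX hY x hx).symm
    rw [sub_eq_sub_iff_add_eq_add] at h ⊢
    rw [h, add_comm]
  have skew : ∀ X Y Z, IsField X → IsField Y → IsField Z →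
      g x (D X Y x - D' X Y x) (Z x) = -g x (D X Z x - D' X Z x) (Y x) := by
    intro X Y Z hX hY hZ
    have h1 := hD.metric_compatible X Y Z hX hY hZ x hx
    have h2 := hD'.metric_compatible X Y Z hX hY hZ x hx
    have t1 := (hD.isField X Y hX hY).tangent x hx
    have t2 := (hD'.isField X Y hX hY).tangent x hx
    have t3 := (hD.isField X Z hX hZ).tangent x hx
    have t4 := (hD'.isField X Z hX hZ).tangent x hx
    have tY := hY.tangent x hx
    have tZ := hZ.tangent x hx
    rw [hsub x hx _ t1 _ t2 _ tZ, hsub x hx _ t3 _ t4 _ tY]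
    rw [hcomm x hx _ tY _ t3] at h1
    rw [hcomm x hx _ tY _ t4] at h2
    linarith
  have zero : ∀ Z, IsField Z → g x (D X Y x - D' X Y x) (Z x) = 0 := by
    intro Z hZ
    have e1 := skew X Y Z hX hY hZ
    rw [symm X Z hX hZ, skew Z X Y hZ hX hY, symm Z Y hZ hY, skew Y Z X hY hZ hX, symm Y X hY hX]
      at e1
    linarith
  have t : D X Y x - D' X Y x ∈ tangent x :=
    sub_mem ((hD.isField X Y hX hY).tangent x hx) ((hD'.isField X Y hX hY).tangent x hx)
  obtain ⟨Z, hZ, hZx⟩ := exists_field t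
  have := zero Z hZ
  rw [hZx] at this
  exact sub_eq_zero.1 (hpos x hx _ t this)

/-- The metric `g(a, c)` has the connection of its deformation parameters as Levi-Civita
connection. -/
theorem isLeviCivita_connection {a c : ℝ} (hc : 0 < c) :
    IsLeviCivita (metric a c : Ambient n p → Ambient n p → Ambient n p → ℝ)
      (connection (1 / c - 1) (-a / c) ((a ^ 2 + c ^ 2) / c - 1)) where
  isField X Y hX hY := isField_connection _ _ _ hX hY
  add_left X X' Y _ _ _ x _ := by
    simp only [connection, Pi.add_apply, map_add, christoffel_add_left]
    abel
  smul_left f X Y _ _ _ x _ := by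
    simp only [connection, map_smul, christoffel_smul_left, smul_add]
  add_right X Y Y' _ hY hY' x _ := by
    simp only [connection, Pi.add_apply, christoffel_add_right]
    rw [fderiv_add (hY.smooth.contDiffAt.differentiableAt (by simp))
      (hY'.smooth.contDiffAt.differentiableAt (by simp)), add_apply]
    abel
  leibniz f X Y hf _ hY x _ := by
    simp only [connection, christoffel_smul_right]
    rw [fderiv_fun_smul (hf.contDiffAt.differentiableAt (by simp))
      (hY.smooth.contDiffAt.differentiableAt (by simp))]
    simp only [add_apply, smul_apply,
      ContinuousLinearMap.smulRight_apply, smul_add]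
    abel
  torsion_free X Y _ _ x _ := by
    rw [connection, connection, christoffel_comm _ _ _ _ (X x), VectorField.lieBracket]
    abel
  metric_compatible X Y Z hX hY hZ x hx := by
    rw [metric_eq_deformed hc hx ((isField_connection _ _ _ hX hY).tangent x hx)
      (hZ.tangent x hx), metric_eq_deformed hc hx (hY.tangent x hx)
      ((isField_connection _ _ _ hX hZ).tangent x hx), ← fderiv_deformed hX hY hZ hx]
    -- The two forms agree only along the submanifold, which suffices as `X x` is tangent to it.
    refine fderiv_congr_on_manifold ?_ ?_ (fun y hy => ?_) hx (hX.tangent x hx)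
    · exact (contDiff_metric a c contDiff_id hY.smooth hZ.smooth).contDiffAt.differentiableAt
        (by simp)
    · exact (contDiff_deformed _ _ _ contDiff_id hY.smooth
        hZ.smooth).contDiffAt.differentiableAt (by simp)
    · exact metric_eq_deformed hc hy (hY.tangent y hy) (hZ.tangent y hy)

/-- The Cauchy–Schwarz inequality against the unit vector `i z`, in the form of the nonnegativity
of the squared norm of `v - vert z v • (i z)`. -/
theorem sq_vert_le {m : ℕ} {z v : EuclideanSpace ℂ (Fin m)} (hz : dot z z = 1) :
    vert z v ^ 2 ≤ dot v v := by
  have h := dot_self_nonneg (v - vert z v • (Complex.I • z))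
  simp only [dot_sub_left, dot_sub_right, dot_smul_left, dot_smul_right, dot_I_left, dot_I_right,
    vert_sub_left, vert_smul_left, vert_I_left, vert_swap v z, hz] at h
  nlinarith [h]

/-- Positive definiteness: the vertical part of `g(a, c)` is `(s - a t)² / c + c t²`. -/
theorem metric_pos {a c : ℝ} (hc : 0 < c) {x u : Ambient n p} (hx : x ∈ manifold n p)
    (hu : u ∈ tangent x) (h : metric a c x u u = 0) : u = 0 := by
  rw [metric_eq_deformed hc hx hu hu, deformed] at h
  have h1 := sq_vert_le (v := u.1) (dot_self_of_mem hx).1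
  have h2 := sq_vert_le (v := u.2) (dot_self_of_mem hx).2
  set s := vert x.1 u.1
  set t := vert x.2 u.2
  have e : (1 / c - 1) * s * s + 2 * (-a / c) * s * t + ((a ^ 2 + c ^ 2) / c - 1) * t * t
      = (s - a * t) ^ 2 / c + c * t ^ 2 - s ^ 2 - t ^ 2 := by
    field_simp
    ring
  have p1 : 0 ≤ (s - a * t) ^ 2 / c := by positivity
  have p2 : 0 ≤ c * t ^ 2 := by positivity
  have q1 : (s - a * t) ^ 2 / c = 0 := by linarith
  have q2 : c * t ^ 2 = 0 := by linarith
  have ht : t = 0 := by simpa [hc.ne'] using q2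
  have hs : s = 0 := by simpa [hc.ne', ht] using q1
  have r : dot u.1 u.1 + dot u.2 u.2 = 0 := by simpa [hs, ht] using h
  have r1 : dot u.1 u.1 = 0 := by linarith [dot_self_nonneg u.1, dot_self_nonneg u.2]
  have r2 : dot u.2 u.2 = 0 := by linarith
  rw [dot_self] at r1 r2
  ext1
  · simpa using r1
  · simpa using r2

theorem metric_comm {a c : ℝ} (hc : 0 < c) {x u v : Ambient n p} (hx : x ∈ manifold n p)
    (hu : u ∈ tangent x) (hv : v ∈ tangent x) : metric a c x u v = metric a c x v u := by
  rw [metric_eq_deformed hc hx hu hv, metric_eq_deformed hc hx hv hu, deformed_comm]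

theorem metric_sub_left {a c : ℝ} (hc : 0 < c) {x u u' v : Ambient n p}
    (hx : x ∈ manifold n p) (hu : u ∈ tangent x) (hu' : u' ∈ tangent x) (hv : v ∈ tangent x) :
    metric a c x (u - u') v = metric a c x u v - metric a c x u' v := by
  rw [metric_eq_deformed hc hx hu hv, metric_eq_deformed hc hx hu' hv,
    metric_eq_deformed hc hx (sub_mem hu hu') hv, eq_sub_iff_add_eq, ← deformed_add_left,
    sub_add_cancel]

/-- On the submanifold, every Levi-Civita connection of `g(a, c)` has the curvature of the
explicit one. -/
theorem IsLeviCivita.curvature_eq {a c : ℝ} (hc : 0 < c)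
    {D : (Ambient n p → Ambient n p) → (Ambient n p → Ambient n p) →
      (Ambient n p → Ambient n p)} (hD : IsLeviCivita (metric a c) D)
    {X Y Z : Ambient n p → Ambient n p} (hX : IsField X) (hY : IsField Y) (hZ : IsField Z)
    {x : Ambient n p} (hx : x ∈ manifold n p) :
    curvature D X Y Z x =
      curvature (connection (1 / c - 1) (-a / c) ((a ^ 2 + c ^ 2) / c - 1)) X Y Z x := by
  have uniq : ∀ {X Y : Ambient n p → Ambient n p}, IsField X → IsField Y →
      ∀ x ∈ manifold n p, D X Y x =
        connection (1 / c - 1) (-a / c) ((a ^ 2 + c ^ 2) / c - 1) X Y x :=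
    fun hX hY x hx => hD.unique (fun y hy u hu u' hu' v hv => metric_sub_left hc hy hu hu' hv)
      (fun y hy u hu v hv => metric_comm hc hy hu hv) (fun y hy u hu h => metric_pos hc hy hu h)
      (isLeviCivita_connection hc) hX hY hx
  have second : ∀ {X Y : Ambient n p → Ambient n p}, IsField X → IsField Y →
      D X (D Y Z) x = connection (1 / c - 1) (-a / c) ((a ^ 2 + c ^ 2) / c - 1) X
        (connection (1 / c - 1) (-a / c) ((a ^ 2 + c ^ 2) / c - 1) Y Z) x := by
    intro X Y hX hY
    have hDY := hD.isField Y Z hY hZ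
    rw [uniq hX hDY x hx, connection, connection, uniq hY hZ x hx]
    congr 1
    exact fderiv_congr_on_manifold (hDY.smooth.contDiffAt.differentiableAt (by simp))
      ((isField_connection _ _ _ hY hZ).smooth.contDiffAt.differentiableAt (by simp))
      (uniq hY hZ) hx (hX.tangent x hx)
  rw [curvature, second hX hY, second hY hX, uniq (hX.lieBracket hY) hZ x hx, curvature]

/-! ### Traces -/

/-- The rank-one operator `u ↦ Re ⟨f, u⟩ v`. -/
def rankOne {m : ℕ} (f v : EuclideanSpace ℂ (Fin m)) :
    EuclideanSpace ℂ (Fin m) →ₗ[ℝ] EuclideanSpace ℂ (Fin m) where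
  toFun u := dot f u • v
  map_add' u u' := by rw [dot_add_right, add_smul]
  map_smul' r u := by rw [dot_smul_right, mul_smul, RingHom.id_apply]

/-- Multiplication by `i` as a real-linear operator. -/
def mulI (m : ℕ) : EuclideanSpace ℂ (Fin m) →ₗ[ℝ] EuclideanSpace ℂ (Fin m) where
  toFun u := Complex.I • u
  map_add' _ _ := smul_add _ _ _
  map_smul' _ _ := smul_comm _ _ _

/-- Orthogonal projection onto the tangent space of the sphere at the unit vector `z`. -/
def sphereProj {m : ℕ} (z : EuclideanSpace ℂ (Fin m)) :
    EuclideanSpace ℂ (Fin m) →ₗ[ℝ] EuclideanSpace ℂ (Fin m) :=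
  LinearMap.id - rankOne z z

theorem rankOne_apply {m : ℕ} (f v u : EuclideanSpace ℂ (Fin m)) :
    rankOne f v u = dot f u • v := rfl

theorem mulI_apply {m : ℕ} (u : EuclideanSpace ℂ (Fin m)) : mulI m u = Complex.I • u := rfl

theorem sphereProj_apply {m : ℕ} (z u : EuclideanSpace ℂ (Fin m)) :
    sphereProj z u = u - dot z u • z := rfl

theorem sphereProj_self {m : ℕ} {z : EuclideanSpace ℂ (Fin m)} (hz : dot z z = 1) :
    sphereProj z z = 0 := by
  rw [sphereProj_apply, hz, one_smul, sub_self]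

theorem sphereProj_of_dot_eq_zero {m : ℕ} {z u : EuclideanSpace ℂ (Fin m)} (h : dot z u = 0) :
    sphereProj z u = u := by
  rw [sphereProj_apply, h, zero_smul, sub_zero]

theorem dot_sphereProj {m : ℕ} {z : EuclideanSpace ℂ (Fin m)} (hz : dot z z = 1)
    (u : EuclideanSpace ℂ (Fin m)) : dot z (sphereProj z u) = 0 := by
  rw [sphereProj_apply, dot_sub_right, dot_smul_right, hz, mul_one, sub_self]

theorem trace_rankOne {m : ℕ} (f v : EuclideanSpace ℂ (Fin m)) :
    LinearMap.trace ℝ _ (rankOne f v) = dot f v := by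
  let l : EuclideanSpace ℂ (Fin m) →ₗ[ℝ] ℝ :=
    { toFun := fun u => dot f u
      map_add' := dot_add_right f
      map_smul' := fun r u => dot_smul_right f u r }
  exact LinearMap.trace_smulRight l v

theorem trace_id_euclidean (m : ℕ) :
    LinearMap.trace ℝ (EuclideanSpace ℂ (Fin m)) LinearMap.id = 2 * m := by
  rw [LinearMap.trace_id, finrank_real_of_complex, finrank_euclideanSpace_fin]
  push_cast
  ring

/-- Complex conjugation of coordinates anticommutes with `i`, so `i` has real trace zero. -/
theorem trace_mulI (m : ℕ) : LinearMap.trace ℝ _ (mulI m) = 0 := by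
  let C : EuclideanSpace ℂ (Fin m) →ₗ[ℝ] EuclideanSpace ℂ (Fin m) :=
    { toFun := fun u => WithLp.toLp 2 fun i => (starRingEnd ℂ) (u i)
      map_add' := fun u v => by ext i; simp
      map_smul' := fun r u => by ext i; simp }
  have h1 : mulI m = (mulI m ∘ₗ C) ∘ₗ C := by
    ext u i
    simp [mulI, C]
  have h2 : C ∘ₗ (mulI m ∘ₗ C) = -mulI m := by
    ext u i
    simp [mulI, C]
  have h3 : LinearMap.trace ℝ _ (mulI m) = -LinearMap.trace ℝ _ (mulI m) := by
    conv_lhs => rw [h1, LinearMap.trace_comp_comm', h2, map_neg]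
  linarith

/-- The trace of an operator on a product is the sum of the traces of its diagonal blocks. -/
theorem trace_prod_eq {V W : Type*} [AddCommGroup V] [Module ℝ V] [Module.Finite ℝ V]
    [AddCommGroup W] [Module ℝ W] [Module.Finite ℝ W] (T : V × W →ₗ[ℝ] V × W) :
    LinearMap.trace ℝ _ T =
      LinearMap.trace ℝ _ (LinearMap.fst ℝ V W ∘ₗ T ∘ₗ LinearMap.inl ℝ V W)
        + LinearMap.trace ℝ _ (LinearMap.snd ℝ V W ∘ₗ T ∘ₗ LinearMap.inr ℝ V W) := by
  have h : T = (T ∘ₗ LinearMap.inl ℝ V W) ∘ₗ LinearMap.fst ℝ V W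
      + (T ∘ₗ LinearMap.inr ℝ V W) ∘ₗ LinearMap.snd ℝ V W := by
    ext u <;> simp [Prod.mk_zero_zero]
  conv_lhs => rw [h, map_add, LinearMap.trace_comp_comm' _ (T ∘ₗ LinearMap.inl ℝ V W),
    LinearMap.trace_comp_comm' _ (T ∘ₗ LinearMap.inr ℝ V W)]

theorem trace_sphereProj_comp {m : ℕ} {z : EuclideanSpace ℂ (Fin m)} (hz : dot z z = 1)
    (L : EuclideanSpace ℂ (Fin m) →ₗ[ℝ] EuclideanSpace ℂ (Fin m)) :
    LinearMap.trace ℝ _ (sphereProj z ∘ₗ L ∘ₗ sphereProj z) =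
      LinearMap.trace ℝ _ L - dot z (L z) := by
  have h : (L ∘ₗ sphereProj z) ∘ₗ sphereProj z = L - rankOne z (L z) := by
    ext1 u
    simp only [LinearMap.comp_apply, LinearMap.sub_apply, rankOne_apply,
      sphereProj_of_dot_eq_zero (dot_sphereProj hz u)]
    rw [sphereProj_apply, map_sub, map_smul]
  rw [LinearMap.trace_comp_comm', h, map_sub, trace_rankOne]

/-- The trace of an endomorphism of the tangent space in terms of its diagonal blocks, each of
which needs to be known only up to multiples of the normal vector. -/
theorem trace_tangent {x : Ambient n p} (hx : x ∈ manifold n p)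
    (A : tangent x →ₗ[ℝ] tangent x)
    (L₁ : EuclideanSpace ℂ (Fin (n + 1)) →ₗ[ℝ] EuclideanSpace ℂ (Fin (n + 1)))
    (L₂ : EuclideanSpace ℂ (Fin (p + 1)) →ₗ[ℝ] EuclideanSpace ℂ (Fin (p + 1)))
    (h₁ : ∀ v (hv : ((v, 0) : Ambient n p) ∈ tangent x),
      sphereProj x.1 (A ⟨(v, 0), hv⟩ : Ambient n p).1 = sphereProj x.1 (L₁ v))
    (h₂ : ∀ v (hv : ((0, v) : Ambient n p) ∈ tangent x),
      sphereProj x.2 (A ⟨(0, v), hv⟩ : Ambient n p).2 = sphereProj x.2 (L₂ v)) :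
    LinearMap.trace ℝ _ A = LinearMap.trace ℝ _ L₁ - dot x.1 (L₁ x.1)
      + (LinearMap.trace ℝ _ L₂ - dot x.2 (L₂ x.2)) := by
  obtain ⟨x1, x2⟩ := dot_self_of_mem hx
  let P : Ambient n p →ₗ[ℝ] tangent x :=
    ((sphereProj x.1).prodMap (sphereProj x.2)).codRestrict (tangent x)
      fun u => mem_tangent.2 ⟨dot_sphereProj x1 _, dot_sphereProj x2 _⟩
  have hP : P ∘ₗ (tangent x).subtype = LinearMap.id := by
    ext1 u
    obtain ⟨u1, u2⟩ := mem_tangent.1 u.2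
    apply Subtype.ext
    exact Prod.ext (sphereProj_of_dot_eq_zero u1) (sphereProj_of_dot_eq_zero u2)
  have hA : LinearMap.trace ℝ _ A = LinearMap.trace ℝ _ ((tangent x).subtype ∘ₗ A ∘ₗ P) := by
    rw [LinearMap.trace_comp_comm', LinearMap.comp_assoc, hP, LinearMap.comp_id]
  rw [hA, trace_prod_eq, ← trace_sphereProj_comp x1, ← trace_sphereProj_comp x2]
  congr 2
  · ext1 v
    have hv : ((sphereProj x.1 v, 0) : Ambient n p) ∈ tangent x :=
      mem_tangent.2 ⟨dot_sphereProj x1 _, dot_zero_right _⟩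
    have e : P (v, 0) = ⟨(sphereProj x.1 v, 0), hv⟩ :=
      Subtype.ext (Prod.ext rfl (map_zero (sphereProj x.2)))
    have t := (mem_tangent.1 (A ⟨(sphereProj x.1 v, 0), hv⟩).2).1
    have := h₁ _ hv
    rw [sphereProj_of_dot_eq_zero t] at this
    simp only [LinearMap.comp_apply, LinearMap.inl_apply, e]
    exact this
  · ext1 v
    have hv : ((0, sphereProj x.2 v) : Ambient n p) ∈ tangent x :=
      mem_tangent.2 ⟨dot_zero_right _, dot_sphereProj x2 _⟩
    have e : P (0, v) = ⟨(0, sphereProj x.2 v), hv⟩ :=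
      Subtype.ext (Prod.ext (map_zero (sphereProj x.1)) rfl)
    have t := (mem_tangent.1 (A ⟨(0, sphereProj x.2 v), hv⟩).2).2
    have := h₂ _ hv
    rw [sphereProj_of_dot_eq_zero t] at this
    simp only [LinearMap.comp_apply, LinearMap.inr_apply, e]
    exact this

/-! ### The Ricci tensor -/

/-- The curvature tensor of the connection with Christoffel tensor `S`, at `x`, as an operator in
its first argument. -/
def curvatureOp (α β γ : ℝ) (x v w : Ambient n p) : Ambient n p →ₗ[ℝ] Ambient n p where
  toFun u := christoffelDeriv α β γ x u v w - christoffelDeriv α β γ x v u w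
    + christoffel α β γ x u (christoffel α β γ x v w)
    - christoffel α β γ x v (christoffel α β γ x u w)
  map_add' u u' := by
    have h1 : christoffelDeriv α β γ x (u + u') v w =
        christoffelDeriv α β γ x u v w + christoffelDeriv α β γ x u' v w := by
      ext1 <;> simp only [christoffelDeriv, Prod.fst_add, Prod.snd_add, vert_add_left,
        smul_add] <;> module
    have h2 : christoffelDeriv α β γ x v (u + u') w =
        christoffelDeriv α β γ x v u w + christoffelDeriv α β γ x v u' w := by
      ext1 <;> simp only [christoffelDeriv, Prod.fst_add, Prod.snd_add, vert_add_right,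
        dot_add_left, smul_add] <;> module
    rw [h1, h2]
    simp only [christoffel_add_left, christoffel_add_right]
    abel
  map_smul' r u := by
    have h1 : christoffelDeriv α β γ x (r • u) v w = r • christoffelDeriv α β γ x u v w := by
      ext1 <;> simp only [christoffelDeriv, Prod.smul_fst, Prod.smul_snd, vert_smul_left] <;>
        module
    have h2 : christoffelDeriv α β γ x v (r • u) w = r • christoffelDeriv α β γ x v u w := by
      ext1 <;> simp only [christoffelDeriv, Prod.smul_fst, Prod.smul_snd, vert_smul_right,
        dot_smul_left, I_smul_real_smul] <;> module
    rw [h1, h2]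
    simp only [christoffel_smul_left, christoffel_smul_right, smul_sub, smul_add,
      RingHom.id_apply]

/-- A diagonal block of `u ↦ R(u, v) w` at the unit vector `z`, up to multiples of `z`. The
parameters are the diagonal coefficient `q` of the deformation, the values `b`, `b'` of the
one-form `β` at `v`, `w`, and the coefficient `k` of `-i`. -/
def curvatureBlock {m : ℕ} (z v w : EuclideanSpace ℂ (Fin m)) (q b b' k : ℝ) :
    EuclideanSpace ℂ (Fin m) →ₗ[ℝ] EuclideanSpace ℂ (Fin m) :=
  -(q • rankOne (Complex.I • w) (Complex.I • v)) - (2 * q) • rankOne (Complex.I • v) (Complex.I • w)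
    - k • mulI m + (dot v w + b' * vert z v + b * vert z w + b * b') • LinearMap.id
    - (rankOne w v + (q * b' + q * vert z w + b') • rankOne (Complex.I • z) v)
    + (q * (dot v w + b' * vert z v + b * vert z w)) •
      rankOne (Complex.I • z) (Complex.I • z)
    - b • (rankOne w (Complex.I • z)
      + (b' + q * vert z w) • rankOne (Complex.I • z) (Complex.I • z))

theorem trace_curvatureBlock {m : ℕ} {z v w : EuclideanSpace ℂ (Fin (m + 1))} (q b b' k : ℝ)
    (hz : dot z z = 1) (hv : dot z v = 0) (hw : dot z w = 0) :
    LinearMap.trace ℝ _ (curvatureBlock z v w q b b' k) - dot z (curvatureBlock z v w q b b' k z) =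
      (2 * m - 2 * q) * (dot v w - vert z v * vert z w)
        + 2 * m * (vert z v + b) * (vert z w + b') := by
  simp only [curvatureBlock, map_add, map_sub, map_neg, map_smul, trace_rankOne, trace_mulI,
    trace_id_euclidean, LinearMap.add_apply, LinearMap.sub_apply, LinearMap.neg_apply,
    LinearMap.smul_apply, rankOne_apply, mulI_apply, LinearMap.id_apply, smul_eq_mul,
    dot_add_right, dot_sub_right, dot_neg_right, dot_smul_right, dot_I_left, dot_I_right,
    vert_I_left, vert_self, dot_comm w v, dot_comm w z, vert_swap v z, vert_swap w z, hz, hv, hw]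
  push_cast
  ring

theorem curvatureOp_fst (α β γ : ℝ) {x v w : Ambient n p} (hx : x ∈ manifold n p)
    (hv : v ∈ tangent x) (hw : w ∈ tangent x) {u : EuclideanSpace ℂ (Fin (n + 1))}
    (hu : ((u, 0) : Ambient n p) ∈ tangent x) :
    sphereProj x.1 (curvatureOp α β γ x v w (u, 0)).1 =
      sphereProj x.1 (curvatureBlock x.1 v.1 w.1 α (α * vert x.1 v.1 + β * vert x.2 v.2)
        (α * vert x.1 w.1 + β * vert x.2 w.2) (α * vert v.1 w.1 + β * vert v.2 w.2) u) := by
  have s1 := christoffel_fst_vert (α := α) (β := β) (γ := γ) hv hw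
  have s2 := christoffel_snd_vert (α := α) (β := β) (γ := γ) hv hw
  have r1 := christoffel_fst_vert (α := α) (β := β) (γ := γ) hu hw
  have r2 := christoffel_snd_vert (α := α) (β := β) (γ := γ) hu hw
  have hS : ∀ y s : Ambient n p, vert x.1 s.1 = 0 → vert x.2 s.2 = 0 →
      (christoffel α β γ x y s).1 = (α * vert x.1 y.1 + β * vert x.2 y.2) • (Complex.I • s.1)
        + (dot y.1 s.1) • x.1 := by
    intro y s h1 h2
    simp [christoffel, sphereChristoffel, h1, h2]
  have hz := sphereProj_self (dot_self_of_mem hx).1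
  have e : (curvatureOp α β γ x v w (u, 0)).1 =
      (christoffelDeriv α β γ x (u, 0) v w).1 - (christoffelDeriv α β γ x v (u, 0) w).1
      + (christoffel α β γ x (u, 0) (christoffel α β γ x v w)).1
      - (christoffel α β γ x v (christoffel α β γ x (u, 0) w)).1 := rfl
  rw [e, hS _ _ s1 s2, hS _ _ r1 r2]
  generalize dot _ (christoffel α β γ x v w).1 = t
  generalize dot _ (christoffel α β γ x (u, 0) w).1 = t'
  simp only [christoffel, sphereChristoffel, christoffelDeriv, curvatureBlock, map_add, map_sub,
    map_neg, map_smul, LinearMap.add_apply, LinearMap.sub_apply, LinearMap.neg_apply,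
    LinearMap.smul_apply, rankOne_apply, mulI_apply, LinearMap.id_apply, hz, smul_add,
    I_smul_real_smul, I_smul_I_smul, dot_I_left, vert_zero_left, vert_zero_right, vert_swap u v.1,
    vert_swap u w.1, dot_comm u w.1]
  module

theorem curvatureOp_snd (α β γ : ℝ) {x v w : Ambient n p} (hx : x ∈ manifold n p)
    (hv : v ∈ tangent x) (hw : w ∈ tangent x) {u : EuclideanSpace ℂ (Fin (p + 1))}
    (hu : ((0, u) : Ambient n p) ∈ tangent x) :
    sphereProj x.2 (curvatureOp α β γ x v w (0, u)).2 =
      sphereProj x.2 (curvatureBlock x.2 v.2 w.2 γ (β * vert x.1 v.1 + γ * vert x.2 v.2)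
        (β * vert x.1 w.1 + γ * vert x.2 w.2) (β * vert v.1 w.1 + γ * vert v.2 w.2) u) := by
  have s1 := christoffel_fst_vert (α := α) (β := β) (γ := γ) hv hw
  have s2 := christoffel_snd_vert (α := α) (β := β) (γ := γ) hv hw
  have r1 := christoffel_fst_vert (α := α) (β := β) (γ := γ) hu hw
  have r2 := christoffel_snd_vert (α := α) (β := β) (γ := γ) hu hw
  have hS : ∀ y s : Ambient n p, vert x.1 s.1 = 0 → vert x.2 s.2 = 0 →
      (christoffel α β γ x y s).2 = (β * vert x.1 y.1 + γ * vert x.2 y.2) • (Complex.I • s.2)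
        + (dot y.2 s.2) • x.2 := by
    intro y s h1 h2
    simp [christoffel, sphereChristoffel, h1, h2]
  have hz := sphereProj_self (dot_self_of_mem hx).2
  have e : (curvatureOp α β γ x v w (0, u)).2 =
      (christoffelDeriv α β γ x (0, u) v w).2 - (christoffelDeriv α β γ x v (0, u) w).2
      + (christoffel α β γ x (0, u) (christoffel α β γ x v w)).2
      - (christoffel α β γ x v (christoffel α β γ x (0, u) w)).2 := rfl
  rw [e, hS _ _ s1 s2, hS _ _ r1 r2]
  generalize dot _ (christoffel α β γ x v w).2 = t
  generalize dot _ (christoffel α β γ x (0, u) w).2 = t'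
  simp only [christoffel, sphereChristoffel, christoffelDeriv, curvatureBlock, map_add, map_sub,
    map_neg, map_smul, LinearMap.add_apply, LinearMap.sub_apply, LinearMap.neg_apply,
    LinearMap.smul_apply, rankOne_apply, mulI_apply, LinearMap.id_apply, hz, smul_add,
    I_smul_real_smul, I_smul_I_smul, dot_I_left, vert_zero_left, vert_zero_right, vert_swap u v.2,
    vert_swap u w.2, dot_comm u w.2]
  module

/-- The Ricci tensor of the metric `⟨·, ·⟩ + α θ₁² + 2β θ₁θ₂ + γ θ₂²`: with `G` the Gram matrix of
the invariant fields, it is `(2n + 2 - 2G₁₁)⟨·, ·⟩` and `(2p + 2 - 2G₂₂)⟨·, ·⟩` on the horizontal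
spaces, and `2 G diag(n, p) G` on the vertical space. -/
def ricci (α β γ : ℝ) (x u v : Ambient n p) : ℝ :=
  (2 * n - 2 * α) * (dot u.1 v.1 - vert x.1 u.1 * vert x.1 v.1)
    + 2 * n * (vert x.1 u.1 + (α * vert x.1 u.1 + β * vert x.2 u.2))
      * (vert x.1 v.1 + (α * vert x.1 v.1 + β * vert x.2 v.2))
    + ((2 * p - 2 * γ) * (dot u.2 v.2 - vert x.2 u.2 * vert x.2 v.2)
    + 2 * p * (vert x.2 u.2 + (β * vert x.1 u.1 + γ * vert x.2 u.2))
      * (vert x.2 v.2 + (β * vert x.1 v.1 + γ * vert x.2 v.2)))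

theorem curvature_eq_curvatureOp (α β γ : ℝ) {V Y Z : Ambient n p → Ambient n p} (hV : IsField V)
    (hY : IsField Y) (hZ : IsField Z) (x : Ambient n p) :
    curvature (connection α β γ) V Y Z x = curvatureOp α β γ x (Y x) (Z x) (V x) :=
  curvature_connection α β γ hV.smooth hY.smooth hZ.smooth x

theorem curvatureOp_mem_tangent (α β γ : ℝ) {Y Z : Ambient n p → Ambient n p}
    (hY : IsField Y) (hZ : IsField Z) {x : Ambient n p} (hx : x ∈ manifold n p)
    {v : Ambient n p} (hv : v ∈ tangent x) : curvatureOp α β γ x (Y x) (Z x) v ∈ tangent x := by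
  obtain ⟨V, hV, rfl⟩ := exists_field hv
  rw [← curvature_eq_curvatureOp α β γ hV hY hZ, curvature]
  exact sub_mem (sub_mem
    ((isField_connection _ _ _ hV (isField_connection _ _ _ hY hZ)).tangent x hx)
    ((isField_connection _ _ _ hY (isField_connection _ _ _ hV hZ)).tangent x hx))
    ((isField_connection _ _ _ (hV.lieBracket hY) hZ).tangent x hx)

theorem trace_curvatureOp (α β γ : ℝ) {Y Z : Ambient n p → Ambient n p}
    (hY : IsField Y) (hZ : IsField Z) {x : Ambient n p} (hx : x ∈ manifold n p) :
    LinearMap.trace ℝ (tangent x) ((curvatureOp α β γ x (Y x) (Z x)).restrict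
      fun _ hv => curvatureOp_mem_tangent α β γ hY hZ hx hv) = ricci α β γ x (Y x) (Z x) := by
  have tY := hY.tangent x hx
  have tZ := hZ.tangent x hx
  obtain ⟨x1, x2⟩ := dot_self_of_mem hx
  rw [trace_tangent hx _ _ _ (fun v hv => curvatureOp_fst α β γ hx tY tZ hv)
    (fun v hv => curvatureOp_snd α β γ hx tY tZ hv)]
  rw [mem_tangent] at tY tZ
  rw [trace_curvatureBlock _ _ _ _ x1 tY.1 tZ.1, trace_curvatureBlock _ _ _ _ x2 tY.2 tZ.2, ricci]

theorem isRicciTensor_ricci {a c : ℝ} (hc : 0 < c) :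
    IsRicciTensor (metric a c : Ambient n p → Ambient n p → Ambient n p → ℝ)
      (ricci (1 / c - 1) (-a / c) ((a ^ 2 + c ^ 2) / c - 1)) := by
  refine ⟨_, isLeviCivita_connection hc, fun Y Z hY hZ x hx => ⟨_, fun V v hV hv => ?_,
    (trace_curvatureOp _ _ _ hY hZ hx).symm⟩⟩
  rw [curvature_eq_curvatureOp _ _ _ hV hY hZ, hv]
  rfl

theorem IsRicciTensor.eq_ricci {a c : ℝ} (hc : 0 < c)
    {ρ : Ambient n p → Ambient n p → Ambient n p → ℝ} (h : IsRicciTensor (metric a c) ρ)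
    {x u v : Ambient n p} (hx : x ∈ manifold n p) (hu : u ∈ tangent x) (hv : v ∈ tangent x) :
    ρ x u v = ricci (1 / c - 1) (-a / c) ((a ^ 2 + c ^ 2) / c - 1) x u v := by
  obtain ⟨Y, hY, rfl⟩ := exists_field hu
  obtain ⟨Z, hZ, rfl⟩ := exists_field hv
  obtain ⟨D, hD, hρ⟩ := h
  obtain ⟨A, hA, e⟩ := hρ Y Z hY hZ x hx
  rw [e, ← trace_curvatureOp _ _ _ hY hZ hx]
  congr 1
  ext1 w
  obtain ⟨W, hW, hWx⟩ := exists_field w.2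
  apply Subtype.ext
  rw [hA W w hW hWx, hD.curvature_eq hc hW hY hZ hx, curvature_eq_curvatureOp _ _ _ hW hY hZ, hWx]
  rfl

/-! ### The Hermitian condition -/

/-- The value of the almost complex structure on a tangent vector, with the horizontal projections
written out. -/
theorem cplx_eq {a c : ℝ} {x u : Ambient n p} (hu : u ∈ tangent x) :
    cplx a c x u =
      ((a / c * vert x.1 u.1 - (a ^ 2 + c ^ 2) / c * vert x.2 u.2) • (Complex.I • x.1)
        + (Complex.I • u.1 + vert x.1 u.1 • x.1),
      (1 / c * vert x.1 u.1 - a / c * vert x.2 u.2) • (Complex.I • x.2)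
        + (Complex.I • u.2 + vert x.2 u.2 • x.2)) := by
  rw [mem_tangent] at hu
  simp only [cplx, horiz_eq _ _ hu.1, horiz_eq _ _ hu.2, smul_sub, I_smul_real_smul,
    I_smul_I_smul, smul_neg, sub_neg_eq_add]

theorem vert_cplx_fst {a c : ℝ} {x u : Ambient n p} (hx : x ∈ manifold n p)
    (hu : u ∈ tangent x) :
    vert x.1 (cplx a c x u).1 = a / c * vert x.1 u.1 - (a ^ 2 + c ^ 2) / c * vert x.2 u.2 := by
  rw [cplx_eq hu]
  simp only [vert_add_right, vert_smul_right, vert_I_right, vert_self, (dot_self_of_mem hx).1,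
    (mem_tangent.1 hu).1]
  ring

theorem vert_cplx_snd {a c : ℝ} {x u : Ambient n p} (hx : x ∈ manifold n p)
    (hu : u ∈ tangent x) :
    vert x.2 (cplx a c x u).2 = 1 / c * vert x.1 u.1 - a / c * vert x.2 u.2 := by
  rw [cplx_eq hu]
  simp only [vert_add_right, vert_smul_right, vert_I_right, vert_self, (dot_self_of_mem hx).2,
    (mem_tangent.1 hu).2]
  ring

theorem cplx_mem_tangent {a c : ℝ} {x u : Ambient n p} (hx : x ∈ manifold n p)
    (hu : u ∈ tangent x) : cplx a c x u ∈ tangent x := by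
  rw [cplx_eq hu, mem_tangent]
  simp [dot_add_right, dot_smul_right, dot_I_right, vert_self, dot_self_of_mem hx]

/-- The almost complex structure is isometric on the horizontal spaces. -/
theorem horizontal_dot_cplx {a c : ℝ} {x u v : Ambient n p} (hx : x ∈ manifold n p)
    (hu : u ∈ tangent x) (hv : v ∈ tangent x) :
    dot (cplx a c x u).1 (cplx a c x v).1
        - vert x.1 (cplx a c x u).1 * vert x.1 (cplx a c x v).1
      = dot u.1 v.1 - vert x.1 u.1 * vert x.1 v.1 ∧
    dot (cplx a c x u).2 (cplx a c x v).2
        - vert x.2 (cplx a c x u).2 * vert x.2 (cplx a c x v).2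
      = dot u.2 v.2 - vert x.2 u.2 * vert x.2 v.2 := by
  rw [vert_cplx_fst hx hu, vert_cplx_fst hx hv, vert_cplx_snd hx hu, vert_cplx_snd hx hv,
    cplx_eq hu, cplx_eq hv]
  rw [mem_tangent] at hu hv
  simp only [dot_add_left, dot_add_right, dot_smul_left, dot_smul_right, dot_I_left, dot_I_right,
    vert_add_left, vert_smul_left, vert_I_left, vert_self, dot_self_of_mem hx, hu, hv,
    vert_swap u.1 x.1, vert_swap u.2 x.2, dot_comm u.1 x.1, dot_comm u.2 x.2]
  constructor <;> ring

theorem manifold_nonempty (n p : ℕ) : (manifold n p).Nonempty :=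
  ⟨(EuclideanSpace.single 0 1, EuclideanSpace.single 0 1), by simp [manifold]⟩

/-- The obstruction to the Hermitian condition is visible on the fields `X¹` and `X²`: on the
vertical plane the Ricci form is `2 G diag(n, p) G`, where `G` is the Gram matrix of the metric. -/
theorem IsRicciTensor.not_isHermitian (hnp : ¬(n = 0 ∧ p = 0)) (h0 : n = 0 ∨ p = 0) {a c : ℝ}
    (hc : 0 < c) {ρ : Ambient n p → Ambient n p → Ambient n p → ℝ}
    (h : IsRicciTensor (metric a c) ρ) : ¬IsHermitian (cplx a c) ρ := by
  intro hH
  obtain ⟨x, hx⟩ := manifold_nonempty n p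
  obtain ⟨x1, x2⟩ := dot_self_of_mem hx
  have key : ∀ u ∈ tangent x,
      ricci (1 / c - 1) (-a / c) ((a ^ 2 + c ^ 2) / c - 1) x (cplx a c x u) (cplx a c x u) =
        ricci (1 / c - 1) (-a / c) ((a ^ 2 + c ^ 2) / c - 1) x u u := by
    intro u hu
    rw [← h.eq_ricci hc hx hu hu,
      ← h.eq_ricci hc hx (cplx_mem_tangent hx hu) (cplx_mem_tangent hx hu)]
    exact hH x hx u hu u hu
  simp only [ricci] at key
  rcases h0 with rfl | rfl
  · have hp : (0 : ℝ) < p := by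
      rw [Nat.cast_pos]; omega
    have hu : ((0, Complex.I • x.2) : Ambient 0 p) ∈ tangent x := by
      simp [mem_tangent, dot_zero_right, dot_I_right, vert_self]
    have e := key _ hu
    rw [(horizontal_dot_cplx hx hu hu).1, (horizontal_dot_cplx hx hu hu).2, vert_cplx_fst hx hu,
      vert_cplx_snd hx hu] at e
    simp only [dot_zero_left, vert_zero_right, vert_I_right, dot_I_right, vert_I_left, x2] at e
    push_cast at e
    field_simp at e
    have pos : 0 < c ^ 2 * (p * (a ^ 2 + c ^ 2) ^ 2) := by positivity
    linarith [show c ^ 2 * (p * (a ^ 2 + c ^ 2) ^ 2) = 0 by linear_combination -e]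
  · have hn : (0 : ℝ) < n := by
      rw [Nat.cast_pos]; omega
    have hu : ((Complex.I • x.1, 0) : Ambient n 0) ∈ tangent x := by
      simp [mem_tangent, dot_zero_right, dot_I_right, vert_self]
    have e := key _ hu
    rw [(horizontal_dot_cplx hx hu hu).1, (horizontal_dot_cplx hx hu hu).2, vert_cplx_fst hx hu,
      vert_cplx_snd hx hu] at e
    simp only [dot_zero_left, vert_zero_right, vert_I_right, dot_I_right, vert_I_left, x1] at e
    push_cast at e
    field_simp at e
    have pos : 0 < c ^ 2 * n := by positivity
    linarith [show c ^ 2 * n = 0 by linear_combination -e]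

/-- For `a = 0` and `p c² = n`, the Ricci form on the vertical plane is a multiple of the
metric. -/
theorem IsRicciTensor.isHermitian {c : ℝ} (hc : 0 < c) (h : p * c ^ 2 = (n : ℝ))
    {ρ : Ambient n p → Ambient n p → Ambient n p → ℝ}
    (hρ : IsRicciTensor (metric 0 c) ρ) : IsHermitian (cplx 0 c) ρ := by
  intro x hx u hu v hv
  rw [hρ.eq_ricci hc hx (cplx_mem_tangent hx hu) (cplx_mem_tangent hx hv),
    hρ.eq_ricci hc hx hu hv, ricci, ricci, (horizontal_dot_cplx hx hu hv).1,
    (horizontal_dot_cplx hx hu hv).2, vert_cplx_fst hx hu, vert_cplx_fst hx hv,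
    vert_cplx_snd hx hu, vert_cplx_snd hx hv, ← h]
  field_simp
  ring

/-! ### The scalar curvature -/

/-- The endomorphism of the tangent space that represents the Ricci tensor with respect to the
metric. -/
def ricciOp (α β γ : ℝ) (x : Ambient n p) : Ambient n p →ₗ[ℝ] Ambient n p where
  toFun u :=
    ((2 * n - 2 * α) • (u.1 - vert x.1 u.1 • (Complex.I • x.1))
        + (2 * n * (vert x.1 u.1 + (α * vert x.1 u.1 + β * vert x.2 u.2))) • (Complex.I • x.1),
      (2 * p - 2 * γ) • (u.2 - vert x.2 u.2 • (Complex.I • x.2))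
        + (2 * p * (vert x.2 u.2 + (β * vert x.1 u.1 + γ * vert x.2 u.2))) • (Complex.I • x.2))
  map_add' u v := by
    ext1 <;> simp only [Prod.fst_add, Prod.snd_add, vert_add_right] <;> module
  map_smul' r u := by
    ext1 <;> simp only [Prod.smul_fst, Prod.smul_snd, vert_smul_right, RingHom.id_apply] <;>
      module

theorem ricciOp_mem_tangent (α β γ : ℝ) {x u : Ambient n p} (hu : u ∈ tangent x) :
    ricciOp α β γ x u ∈ tangent x := by
  rw [mem_tangent] at hu ⊢
  simp [ricciOp, dot_add_right, dot_sub_right, dot_smul_right, dot_I_right, vert_self, hu]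

theorem deformed_ricciOp (α β γ : ℝ) {x u v : Ambient n p} (hx : x ∈ manifold n p) :
    deformed α β γ x (ricciOp α β γ x u) v = ricci α β γ x u v := by
  simp only [deformed, ricciOp, ricci, LinearMap.coe_mk, AddHom.coe_mk, dot_add_left,
    dot_sub_left, dot_smul_left, dot_I_left, vert_add_right, vert_sub_right, vert_smul_right,
    vert_I_right, dot_self_of_mem hx]
  ring

/-- A diagonal block of the Ricci endomorphism. -/
def ricciBlock {m : ℕ} (z : EuclideanSpace ℂ (Fin m)) (r s : ℝ) :
    EuclideanSpace ℂ (Fin m) →ₗ[ℝ] EuclideanSpace ℂ (Fin m) :=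
  r • (LinearMap.id - rankOne (Complex.I • z) (Complex.I • z))
    + s • rankOne (Complex.I • z) (Complex.I • z)

theorem trace_ricciBlock {m : ℕ} {z : EuclideanSpace ℂ (Fin (m + 1))} (hz : dot z z = 1)
    (r s : ℝ) :
    LinearMap.trace ℝ _ (ricciBlock z r s) - dot z (ricciBlock z r s z) = 2 * m * r + s := by
  simp only [ricciBlock, map_add, map_sub, map_smul, trace_rankOne, trace_id_euclidean,
    LinearMap.add_apply, LinearMap.sub_apply, LinearMap.smul_apply, rankOne_apply,
    LinearMap.id_apply, smul_eq_mul, dot_add_right, dot_sub_right, dot_smul_right, dot_I_left,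
    dot_I_right, vert_I_left, vert_self, hz]
  push_cast
  ring

theorem trace_ricciOp (α β γ : ℝ) {x : Ambient n p} (hx : x ∈ manifold n p) :
    LinearMap.trace ℝ (tangent x) ((ricciOp α β γ x).restrict
      fun _ hu => ricciOp_mem_tangent α β γ hu) =
      2 * n * (2 * n - 2 * α) + 2 * n * (1 + α)
        + (2 * p * (2 * p - 2 * γ) + 2 * p * (1 + γ)) := by
  obtain ⟨x1, x2⟩ := dot_self_of_mem hx
  rw [trace_tangent hx _ (ricciBlock x.1 (2 * n - 2 * α) (2 * n * (1 + α)))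
    (ricciBlock x.2 (2 * p - 2 * γ) (2 * p * (1 + γ))), trace_ricciBlock x1, trace_ricciBlock x2]
  · intro v hv
    congr 1
    simp only [LinearMap.restrict_apply, ricciOp, LinearMap.coe_mk, AddHom.coe_mk, ricciBlock,
      LinearMap.add_apply, LinearMap.sub_apply, LinearMap.smul_apply, rankOne_apply,
      LinearMap.id_apply, dot_I_left, vert_zero_right]
    module
  · intro v hv
    congr 1
    simp only [LinearMap.restrict_apply, ricciOp, LinearMap.coe_mk, AddHom.coe_mk, ricciBlock,
      LinearMap.add_apply, LinearMap.sub_apply, LinearMap.smul_apply, rankOne_apply,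
      LinearMap.id_apply, dot_I_left, vert_zero_right]
    module

/-- The scalar curvature of `g(a, c)` as a function of `(a, c)`. -/
def scalarCurvature (n p : ℕ) (q : ℝ × ℝ) : ℝ :=
  4 * n * (n + 1) + 4 * p * (p + 1) - 2 * n * q.2⁻¹ - 2 * p * (q.1 ^ 2 * q.2⁻¹ + q.2)

theorem hasScalarCurvature_metric {a c : ℝ} (hc : 0 < c) :
    HasScalarCurvature (metric a c : Ambient n p → Ambient n p → Ambient n p → ℝ)
      (scalarCurvature n p (a, c)) := by
  refine ⟨_, isRicciTensor_ricci hc, fun x hx => ⟨_, fun u v => ?_,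
    (trace_ricciOp (1 / c - 1) (-a / c) ((a ^ 2 + c ^ 2) / c - 1) hx).trans ?_⟩⟩
  · rw [metric_eq_deformed hc hx (Subtype.coe_prop _) v.2]
    exact deformed_ricciOp _ _ _ hx
  · rw [scalarCurvature]
    field_simp
    ring

theorem hasFDerivAt_scalarCurvature (n p : ℕ) {q : ℝ × ℝ} (hq : 0 < q.2) :
    HasFDerivAt (scalarCurvature n p)
      ((-(4 * p * q.1 * q.2⁻¹)) • ContinuousLinearMap.fst ℝ ℝ ℝ
        + (2 * n * (q.2 ^ 2)⁻¹ + 2 * p * (q.1 ^ 2 * (q.2 ^ 2)⁻¹) - 2 * p) •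
          ContinuousLinearMap.snd ℝ ℝ ℝ) q := by
  have h1 : HasFDerivAt (fun q : ℝ × ℝ => q.1) (ContinuousLinearMap.fst ℝ ℝ ℝ) q := hasFDerivAt_fst
  have h2 : HasFDerivAt (fun q : ℝ × ℝ => q.2) (ContinuousLinearMap.snd ℝ ℝ ℝ) q := hasFDerivAt_snd
  have h3 := (hasDerivAt_inv hq.ne').comp_hasFDerivAt q h2
  refine (((h3.const_mul (2 * n : ℝ)).const_sub (4 * n * (n + 1) + 4 * p * (p + 1))).sub
    ((((h1.pow 2).mul h3).add h2).const_mul (2 * p : ℝ))).congr_fderiv ?_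
  ext
  · simp
    ring
  · simp
    ring

theorem fderiv_scalarCurvature_eq_zero_iff (n p : ℕ) {q : ℝ × ℝ} (hq : 0 < q.2) :
    fderiv ℝ (scalarCurvature n p) q = 0 ↔
      p * q.1 = 0 ∧ n + p * q.1 ^ 2 = p * q.2 ^ 2 := by
  rw [(hasFDerivAt_scalarCurvature n p hq).fderiv]
  constructor
  · intro h
    have e1 := DFunLike.congr_fun h (1, 0)
    have e2 := DFunLike.congr_fun h (0, 1)
    simp only [add_apply, smul_apply, ContinuousLinearMap.coe_fst', ContinuousLinearMap.coe_snd',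
      smul_eq_mul, zero_apply, mul_one, mul_zero, add_zero, zero_add] at e1 e2
    field_simp at e2
    exact ⟨by simpa [hq.ne'] using e1, by linarith⟩
  · rintro ⟨e1, e2⟩
    have f1 : -(4 * p * q.1 * q.2⁻¹) = 0 := by
      rw [mul_assoc 4, e1]; ring
    have f2 : 2 * n * (q.2 ^ 2)⁻¹ + 2 * p * (q.1 ^ 2 * (q.2 ^ 2)⁻¹) - 2 * p = 0 := by
      field_simp
      linarith
    rw [f1, f2, zero_smul, zero_smul, add_zero]

end SphereProduct
end

theorem proposition4 (n p : ℕ) (hnp : ¬(n = 0 ∧ p = 0)) :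
    (∀ a c : ℝ, 0 < c → ∃ ρ : SphereProduct.Ambient n p → SphereProduct.Ambient n p →
        SphereProduct.Ambient n p → ℝ,
      SphereProduct.IsRicciTensor (SphereProduct.metric a c) ρ) ∧
    (n = 0 ∨ p = 0 → ∀ a c : ℝ, 0 < c → ∀ ρ : SphereProduct.Ambient n p →
        SphereProduct.Ambient n p → SphereProduct.Ambient n p → ℝ,
      SphereProduct.IsRicciTensor (SphereProduct.metric a c) ρ →
        ¬ SphereProduct.IsHermitian (SphereProduct.cplx a c) ρ) ∧
    (n ≠ 0 ∧ p ≠ 0 → ∀ ρ : SphereProduct.Ambient n p → SphereProduct.Ambient n p →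
        SphereProduct.Ambient n p → ℝ,
      SphereProduct.IsRicciTensor (SphereProduct.metric 0 √((n : ℝ) / p)) ρ →
        SphereProduct.IsHermitian (SphereProduct.cplx 0 √((n : ℝ) / p)) ρ) ∧
    ∃ s : ℝ × ℝ → ℝ,
      (∀ a c : ℝ, 0 < c → SphereProduct.HasScalarCurvature
        (SphereProduct.metric a c : SphereProduct.Ambient n p → SphereProduct.Ambient n p →
          SphereProduct.Ambient n p → ℝ) (s (a, c))) ∧
      DifferentiableOn ℝ s {q | 0 < q.2} ∧
      (n = 0 ∨ p = 0 → ∀ q : ℝ × ℝ, 0 < q.2 → fderiv ℝ s q ≠ 0) ∧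
      (n ≠ 0 ∧ p ≠ 0 →
        (∀ q : ℝ × ℝ, 0 < q.2 → (fderiv ℝ s q = 0 ↔ q = (0, √((n : ℝ) / p)))) ∧
        (∀ q : ℝ × ℝ, 0 < q.2 → s q ≤ s (0, √((n : ℝ) / p))) ∧
        s (0, √((n : ℝ) / p)) =
          4 * (n : ℝ) * (n + 1) + 4 * (p : ℝ) * (p + 1) - 4 * √((n : ℝ) * p)) := by
  have root : n ≠ 0 ∧ p ≠ 0 → (0 : ℝ) < p ∧ 0 < √((n : ℝ) / p) ∧
      p * √((n : ℝ) / p) ^ 2 = n := by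
    rintro ⟨hn, hp⟩
    have hn' : (0 : ℝ) < n := Nat.cast_pos.2 (Nat.pos_of_ne_zero hn)
    have hp' : (0 : ℝ) < p := Nat.cast_pos.2 (Nat.pos_of_ne_zero hp)
    refine ⟨hp', by positivity, ?_⟩
    rw [Real.sq_sqrt (by positivity)]
    field_simp
  refine ⟨fun a c hc => ⟨_, SphereProduct.isRicciTensor_ricci hc⟩,
    fun h0 a c hc ρ hρ => hρ.not_isHermitian hnp h0 hc,
    fun h ρ hρ => hρ.isHermitian (root h).2.1 (root h).2.2,
    SphereProduct.scalarCurvature n p, fun a c hc => SphereProduct.hasScalarCurvature_metric hc,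
    fun q hq => (SphereProduct.hasFDerivAt_scalarCurvature n p
      hq).differentiableAt.differentiableWithinAt, ?_, ?_⟩
  · intro h0 q hq h
    rw [SphereProduct.fderiv_scalarCurvature_eq_zero_iff n p hq] at h
    obtain ⟨e1, e2⟩ := h
    rcases h0 with rfl | rfl
    · have hp : (p : ℝ) ≠ 0 := Nat.cast_ne_zero.2 (by omega)
      have ha : q.1 = 0 := by simpa [hp] using e1
      simp [ha, hp, hq.ne'] at e2
    · have hn : (n : ℝ) ≠ 0 := Nat.cast_ne_zero.2 (by omega)
      simp [hn] at e2
  · intro h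
    obtain ⟨hp, hr, e⟩ := root h
    have hs : √((n : ℝ) * p) = p * √((n : ℝ) / p) := by
      rw [Real.sqrt_eq_iff_mul_self_eq (by positivity) (by positivity)]
      linear_combination (-p : ℝ) * e
    rw [hs]
    generalize √((n : ℝ) / p) = r at *
    have hmax : SphereProduct.scalarCurvature n p (0, r) =
        4 * n * (n + 1) + 4 * p * (p + 1) - 4 * (p * r) := by
      rw [SphereProduct.scalarCurvature]
      field_simp
      linear_combination 2 * e
    refine ⟨fun q hq => ?_, fun q hq => ?_, hmax⟩
    · rw [SphereProduct.fderiv_scalarCurvature_eq_zero_iff n p hq]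
      constructor
      · rintro ⟨e1, e2⟩
        have ha : q.1 = 0 := by simpa [hp.ne'] using e1
        have hc : q.2 ^ 2 = r ^ 2 := by
          apply mul_left_cancel₀ hp.ne'
          rw [e, ← e2, ha]
          ring
        exact Prod.ext ha ((pow_left_inj₀ hq.le hr.le two_ne_zero).1 hc)
      · rintro rfl
        simp [e]
    · rw [hmax, SphereProduct.scalarCurvature]
      have h1 : 0 ≤ 2 * p * (q.1 ^ 2 * q.2⁻¹) := by positivity
      -- The inequality of arithmetic and geometric means for `n / c` and `p c`.
      have h2 : 0 ≤ 2 * p * ((q.2 - r) ^ 2 * q.2⁻¹) := by positivity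
      have h3 : 2 * p * ((q.2 - r) ^ 2 * q.2⁻¹) = 2 * p * q.2 - 4 * (p * r) + 2 * n * q.2⁻¹ := by
        rw [← e]
        field_simp
        ring
      linarith
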